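/- Let $d\in\{2,3\}$ and let $\mathcal T_h$ be a triangulation in $\mathbb R^d$, i.e. a finite conforming simplicial mesh all of whose faces are faces of $d$-dimensional simplices, the elements (triangles for $d=2$, tetrahedra for $d=3$). Let $\Omega_h\subset\mathbb R^d$ be the union of the elements and $\Gamma_h:=\partial\Omega_h$. Let $(x_k)_{k\in\mathcal N_\Omega}$ be the nodes of $\mathcal T_h$, let $\mathcal N_\Gamma\subseteq\mathcal N_\Omega$ be the set of the indices of the nodes on $\Gamma_h$, and let $\phi_j$ be the continuous, piecewise linear nodal basis functions on $\Omega_h$, i.e. $\phi_j$ is affine on each element and $\phi_j(x_k)=\delta_{jk}$. Define the bulk mass matrix $M_\Omega$, its block $M_{22}$ belonging to the boundary nodes, and the surface mass matrix $M_\Gamma$ by \[ (M_\Omega)_{ij}=\int_{\Omega_h}\phi_j\phi_i\,\mathrm dx\quad(i,j\in\mathcal N_\Omega),\qquad M_{22}=\big((M_\Omega)_{ij}\big)_{i,j\in\mathcal N_\Gamma},\qquad (M_\Gamma)_{ij}=\int_{\Gamma_h}\phi_j\phi_i\,\mathrm d\sigma\quad(i,j\in\mathcal N_\Gamma), \] where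 $\sigma$ is the surface measure (length for $d=2$, area for $d=3$), and write $\|z\|_M^2:=z^{\mathsf T}Mz$. Let $h_\Gamma$ be the maximal mesh width on $\Gamma_h$, i.e. the largest diameter of a $(d-1)$-dimensional face of the triangulation that is contained in $\Gamma_h$. For every $\vartheta\ge 2$ there is a constant $c_M>0$ that depends only on $\vartheta$ such that the following holds: if $d\in\{2,3\}$ and $\mathcal T_h$ is quasi-uniform with parameter $\vartheta$, i.e. $r/R\ge\vartheta^{-1}$ for the inradius $r$ and the circumradius $R$ of every element of $\mathcal T_h$, then \[ \|z\|_{M_{22}}^2\;\le\; c_M\,h_\Gamma\,\|z\|_{M_\Gamma}^2\qquad\text{for all } z\in\mathbb R^{\mathcal N_\Gamma}. \] -/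

import Mathlib

open scoped MeasureTheory Matrix

namespace BulkSurface

/-- A (finite, conforming) simplicial triangulation in `ℝ^d`: a finite simplicial complex all of
whose faces are faces of `d`-dimensional simplices, the elements. Two elements meet in a common
face or not at all (this is part of `Geometry.SimplicialComplex`). -/
structure Triangulation (d : ℕ) extends
    Geometry.SimplicialComplex ℝ (EuclideanSpace ℝ (Fin d)) where
  finite_faces : faces.Finite
  exists_element : ∀ s ∈ faces, ∃ t ∈ faces, s ⊆ t ∧ t.card = d + 1

namespace Triangulation

variable {d : ℕ} (T : Triangulation d)

/-- The closed polyhedral set `Ω_h` covered by the triangulation. -/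
def bulk : Set (EuclideanSpace ℝ (Fin d)) := T.toSimplicialComplex.space

/-- The discrete boundary `Γ_h = ∂Ω_h`. -/
def surface : Set (EuclideanSpace ℝ (Fin d)) := frontier T.bulk

/-- The nodes of the triangulation. -/
def BulkNode : Type := {v : EuclideanSpace ℝ (Fin d) // v ∈ T.toSimplicialComplex.vertices}

/-- The nodes of the triangulation that lie on the discrete boundary `Γ_h`. -/
def SurfaceNode : Type := {v : T.BulkNode // v.1 ∈ T.surface}

instance : Finite T.BulkNode := by
  have := T.finite_faces.to_subtype
  refine Finite.of_injective
    (fun v : T.BulkNode => (⟨{v.1}, v.2⟩ : T.toSimplicialComplex.faces)) ?_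
  intro v w h
  apply Subtype.ext
  simpa using congrArg (fun s : T.toSimplicialComplex.faces => s.1) h

instance : Finite T.SurfaceNode := inferInstanceAs (Finite (Subtype _))

noncomputable instance : Fintype T.BulkNode := Fintype.ofFinite _

noncomputable instance : Fintype T.SurfaceNode := Fintype.ofFinite _

/-- The simplices of dimension `d - 1` that make up the discrete boundary `Γ_h`. -/
def surfaceFaces : Set (Finset (EuclideanSpace ℝ (Fin d))) :=
  {s | s ∈ T.toSimplicialComplex.faces ∧ s.card = d ∧
    convexHull ℝ (s : Set (EuclideanSpace ℝ (Fin d))) ⊆ T.surface}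

/-- The maximal mesh width `h_Γ` on the discrete boundary. -/
noncomputable def surfaceMeshWidth : ℝ :=
  ⨆ s : T.surfaceFaces, Metric.diam (convexHull ℝ (s.1 : Set (EuclideanSpace ℝ (Fin d))))

/-- Quasi-uniformity with parameter `ϑ`: `r / R ≥ ϑ⁻¹` for the inradius `r` and the circumradius
`R` of every element. -/
def IsQuasiUniform [NeZero d] (ϑ : ℝ) : Prop :=
  ∀ E : Affine.Simplex ℝ (EuclideanSpace ℝ (Fin d)) d,
    (∃ s ∈ T.toSimplicialComplex.faces, (s : Set (EuclideanSpace ℝ (Fin d))) = Set.range E.points) →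
      ϑ⁻¹ ≤ E.inradius / E.circumradius

/-! ### Nodal basis functions -/

/-- `w` is the family of barycentric coordinates of the point `x` in the simplex with vertex set
`s`, extended by zero to all other points. -/
def IsBarycentric (s : Finset (EuclideanSpace ℝ (Fin d))) (x : EuclideanSpace ℝ (Fin d))
    (w : EuclideanSpace ℝ (Fin d) → ℝ) : Prop :=
  (∀ v ∈ s, 0 ≤ w v) ∧ (∀ v, v ∉ s → w v = 0) ∧ ∑ v ∈ s, w v = 1 ∧ ∑ v ∈ s, w v • v = x

open Classical in
/-- The piecewise linear nodal basis function of the node `v`: its value at a point `x` of `Ω_h` is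
the barycentric coordinate of `x` with respect to `v` in a simplex of the triangulation that
contains `x`; outside `Ω_h` it is zero by convention. -/
noncomputable def nodalBasis (v x : EuclideanSpace ℝ (Fin d)) : ℝ :=
  if h : ∃ w, ∃ s ∈ T.toSimplicialComplex.faces, IsBarycentric s x w then h.choose v else 0

/-! The next facts verify that `nodalBasis v` is the unique function on `Ω_h` that is continuous,
affine on every element, one at the node `v` and zero at the other nodes. -/

theorem IsBarycentric.mem_convexHull {s : Finset (EuclideanSpace ℝ (Fin d))}
    {x : EuclideanSpace ℝ (Fin d)} {w : EuclideanSpace ℝ (Fin d) → ℝ}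
    (h : IsBarycentric s x w) : x ∈ convexHull ℝ (s : Set (EuclideanSpace ℝ (Fin d))) :=
  Finset.mem_convexHull'.2 ⟨w, h.1, h.2.2.1, h.2.2.2⟩

theorem exists_isBarycentric {s : Finset (EuclideanSpace ℝ (Fin d))}
    {x : EuclideanSpace ℝ (Fin d)}
    (h : x ∈ convexHull ℝ (s : Set (EuclideanSpace ℝ (Fin d)))) : ∃ w, IsBarycentric s x w := by
  classical
  obtain ⟨w, h0, h1, h2⟩ := Finset.mem_convexHull'.1 h
  refine ⟨fun v => if v ∈ s then w v else 0, fun v hv => by simpa [hv] using h0 v hv,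
    fun v hv => by simp [hv], ?_, ?_⟩
  · rw [← h1]; exact Finset.sum_congr rfl fun v hv => by simp [hv]
  · rw [← h2]; exact Finset.sum_congr rfl fun v hv => by simp [hv]

/-- On a face of the triangulation, there are affine functions that return the barycentric
coordinates. -/
theorem exists_affineMap {s : Finset (EuclideanSpace ℝ (Fin d))}
    (hs : s ∈ T.toSimplicialComplex.faces) (v : EuclideanSpace ℝ (Fin d)) :
    ∃ f : EuclideanSpace ℝ (Fin d) →ᵃ[ℝ] ℝ,
      ∀ x w, IsBarycentric s x w → w v = f x := by
  classical
  by_cases hv : v ∈ s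
  · obtain ⟨t, hst, ht, htop⟩ :=
      exists_subset_affineIndependent_affineSpan_eq_top (T.indep hs)
    let b : AffineBasis t ℝ (EuclideanSpace ℝ (Fin d)) :=
      ⟨((↑) : t → EuclideanSpace ℝ (Fin d)), ht, by simpa using htop⟩
    refine ⟨b.coord ⟨v, hst (by simpa using hv)⟩, fun x w hw => ?_⟩
    have hx : x = s.affineCombination ℝ id w := by
      rw [Finset.affineCombination_eq_linear_combination _ _ _ hw.2.2.1]
      simpa using hw.2.2.2.symm
    rw [hx, Finset.map_affineCombination _ _ _ hw.2.2.1,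
      Finset.affineCombination_eq_linear_combination _ _ _ hw.2.2.1,
      Finset.sum_eq_single_of_mem v hv]
    · have h1 : b.coord ⟨v, hst (by simpa using hv)⟩ (b ⟨v, hst (by simpa using hv)⟩) = 1 :=
        b.coord_apply_eq _
      have h2 : b ⟨v, hst (by simpa using hv)⟩ = v := rfl
      rw [h2] at h1
      simp [h1]
    · intro u hu huv
      have h1 : b.coord ⟨v, hst (by simpa using hv)⟩ (b ⟨u, hst (by simpa using hu)⟩) = 0 :=
        b.coord_apply_ne (by simpa using Ne.symm huv)
      have h2 : b ⟨u, hst (by simpa using hu)⟩ = u := rfl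
      rw [h2] at h1
      simp [h1]
  · exact ⟨AffineMap.const ℝ _ 0, fun x w hw => by simpa using hw.2.1 v hv⟩

theorem IsBarycentric.mono {s t : Finset (EuclideanSpace ℝ (Fin d))}
    {x : EuclideanSpace ℝ (Fin d)} {w : EuclideanSpace ℝ (Fin d) → ℝ}
    (h : IsBarycentric s x w) (hst : s ⊆ t) : IsBarycentric t x w := by
  refine ⟨fun v _ => ?_, fun v hv => h.2.1 v fun hv' => hv (hst hv'), ?_, ?_⟩
  · by_cases hv : v ∈ s
    · exact h.1 v hv
    · exact (h.2.1 v hv).ge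
  · rw [← h.2.2.1]
    exact (Finset.sum_subset hst fun v _ hv => h.2.1 v hv).symm
  · rw [← h.2.2.2]
    exact (Finset.sum_subset hst fun v _ hv => by simp [h.2.1 v hv]).symm

/-- Barycentric coordinates do not depend on the simplex of the triangulation in which they are
taken. -/
theorem isBarycentric_unique {s t : Finset (EuclideanSpace ℝ (Fin d))}
    (hs : s ∈ T.toSimplicialComplex.faces) (ht : t ∈ T.toSimplicialComplex.faces)
    {x : EuclideanSpace ℝ (Fin d)} {w z : EuclideanSpace ℝ (Fin d) → ℝ}
    (hw : IsBarycentric s x w) (hz : IsBarycentric t x z) : w = z := by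
  classical
  have hx := T.inter_subset_convexHull hs ht ⟨hw.mem_convexHull, hz.mem_convexHull⟩
  rw [← Finset.coe_inter] at hx
  obtain ⟨y, hy⟩ := exists_isBarycentric hx
  funext v
  obtain ⟨f, hf⟩ := T.exists_affineMap hs v
  obtain ⟨g, hg⟩ := T.exists_affineMap ht v
  rw [hf x w hw, ← hf x y (hy.mono Finset.inter_subset_left), hg x z hz,
    ← hg x y (hy.mono Finset.inter_subset_right)]

theorem nodalBasis_eq {s : Finset (EuclideanSpace ℝ (Fin d))}
    (hs : s ∈ T.toSimplicialComplex.faces) {x : EuclideanSpace ℝ (Fin d)}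
    {w : EuclideanSpace ℝ (Fin d) → ℝ} (hw : IsBarycentric s x w)
    (v : EuclideanSpace ℝ (Fin d)) : T.nodalBasis v x = w v := by
  have h : ∃ w, ∃ s ∈ T.toSimplicialComplex.faces, IsBarycentric s x w := ⟨w, s, hs, hw⟩
  obtain ⟨t, ht, hz⟩ := h.choose_spec
  rw [nodalBasis, dif_pos h, T.isBarycentric_unique ht hs hz hw]

open Classical in
/-- The nodal basis functions satisfy `φ_j(x_k) = δ_{jk}`. -/
theorem nodalBasis_node (v w : T.BulkNode) :
    T.nodalBasis v.1 w.1 = if v = w then 1 else 0 := by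
  have hb : IsBarycentric {w.1} w.1 (fun u => if u = w.1 then 1 else 0) :=
    ⟨by simp, by simp, by simp, by simp⟩
  rw [T.nodalBasis_eq w.2 hb]
  exact if_congr Subtype.ext_iff.symm rfl rfl

/-- The nodal basis functions are affine on every simplex of the triangulation. -/
theorem nodalBasis_affine {s : Finset (EuclideanSpace ℝ (Fin d))}
    (hs : s ∈ T.toSimplicialComplex.faces) (v : EuclideanSpace ℝ (Fin d)) :
    ∃ f : EuclideanSpace ℝ (Fin d) →ᵃ[ℝ] ℝ,
      Set.EqOn (T.nodalBasis v) f (convexHull ℝ (s : Set (EuclideanSpace ℝ (Fin d)))) := by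
  obtain ⟨f, hf⟩ := T.exists_affineMap hs v
  refine ⟨f, fun x hx => ?_⟩
  obtain ⟨w, hw⟩ := exists_isBarycentric hx
  rw [T.nodalBasis_eq hs hw, hf x w hw]

/-- The nodal basis functions are continuous on `Ω_h`. -/
theorem nodalBasis_continuousOn (v : EuclideanSpace ℝ (Fin d)) :
    ContinuousOn (T.nodalBasis v) T.bulk := by
  have := T.finite_faces.to_subtype
  have hU : T.bulk = ⋃ s : T.toSimplicialComplex.faces,
      convexHull ℝ (s.1 : Set (EuclideanSpace ℝ (Fin d))) := by
    rw [bulk, Geometry.SimplicialComplex.space, Set.biUnion_eq_iUnion]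
  rw [hU]
  refine (locallyFinite_of_finite _).continuousOn_iUnion
    (fun s => (s.1.finite_toSet.isCompact_convexHull ℝ).isClosed) fun s => ?_
  obtain ⟨f, hf⟩ := T.nodalBasis_affine s.2 v
  exact f.continuous_of_finiteDimensional.continuousOn.congr hf

/-- A function on `Ω_h` that is affine on every simplex of the triangulation and has the nodal
values of the basis function of `v` is this basis function. -/
theorem eq_nodalBasis (v : EuclideanSpace ℝ (Fin d)) (g : EuclideanSpace ℝ (Fin d) → ℝ)
    (hg : ∀ s ∈ T.toSimplicialComplex.faces, ∃ f : EuclideanSpace ℝ (Fin d) →ᵃ[ℝ] ℝ,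
      Set.EqOn g f (convexHull ℝ (s : Set (EuclideanSpace ℝ (Fin d)))))
    (hv : ∀ u ∈ T.toSimplicialComplex.vertices, g u = T.nodalBasis v u) :
    Set.EqOn g (T.nodalBasis v) T.bulk := by
  intro x hx
  obtain ⟨s, hs, hxs⟩ := Geometry.SimplicialComplex.mem_space_iff.1 hx
  obtain ⟨f, hf⟩ := hg s hs
  obtain ⟨k, hk⟩ := T.nodalBasis_affine hs v
  rw [hf hxs, hk hxs]
  have hsub : (s : Set (EuclideanSpace ℝ (Fin d))) ⊆
      convexHull ℝ (s : Set (EuclideanSpace ℝ (Fin d))) := subset_convexHull ℝ _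
  have hfk : Set.EqOn f k (affineSpan ℝ (s : Set (EuclideanSpace ℝ (Fin d)))) := by
    refine AffineMap.eqOn_affineSpan fun u hu => ?_
    have hu' : u ∈ T.toSimplicialComplex.vertices :=
      T.toSimplicialComplex.down_closed hs (by simpa using hu) (Finset.singleton_nonempty u)
    rw [← hf (hsub hu), ← hk (hsub hu), hv u hu']
  exact hfk (convexHull_subset_affineSpan _ hxs)

/-! ### Mass matrices -/

/-- The bulk mass matrix `M_Ω`, with entries `∫_{Ω_h} φ_j φ_i dx`, indexed by all nodes. -/
noncomputable def bulkMass : Matrix T.BulkNode T.BulkNode ℝ :=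
  fun i j => ∫ x in T.bulk, T.nodalBasis j.1 x * T.nodalBasis i.1 x

/-- The block `M₂₂` of the bulk mass matrix that belongs to the nodes on `Γ_h`. -/
noncomputable def bulkMass22 : Matrix T.SurfaceNode T.SurfaceNode ℝ :=
  T.bulkMass.submatrix Subtype.val Subtype.val

/-- The surface mass matrix `M_Γ`, with entries `∫_{Γ_h} φ_j φ_i dσ`, indexed by the nodes on `Γ_h`.
The surface measure is the `(d - 1)`-dimensional Hausdorff measure, normalized as usual. -/
noncomputable def surfaceMass : Matrix T.SurfaceNode T.SurfaceNode ℝ :=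
  fun i j => ∫ x in T.surface, T.nodalBasis j.1.1 x * T.nodalBasis i.1.1 x ∂μHE[d - 1]

end Triangulation

/-- The squared norm `‖z‖_M² = zᵀ M z` that belongs to a symmetric positive (semi)definite
matrix `M`. -/
def sqNorm {ι : Type*} [Fintype ι] (M : Matrix ι ι ℝ) (z : ι → ℝ) : ℝ := z ⬝ᵥ (M *ᵥ z)

end BulkSurface

/-!
The squared norm of `z` in the bulk is the integral over `Ω_h` of `u²`, where `u` is the finite
element function with the values `z` at the boundary nodes and zero at the interior nodes
(`boundaryFunction`). Since the nodal basis is a nonnegative partition of unity, convexity of the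
square gives `u² ≤ ∑ z_v² φ_v`, so it suffices to bound the integral of `φ_v` for every boundary
node `v`. The star of `v`, on which `φ_v` lives, lies in the ball about `v` whose radius is the
largest diameter of an element of the star. Hence the theorem follows if `v` belongs to a boundary
face `F` whose size is comparable with this largest diameter `δ`: then the integral of `φ_v` is at
most a constant times `δ ^ d`, hence at most a constant times `h_Γ` times the area of `F`.

Elements that only share a vertex may be of very different size, but elements with a common facet
are comparable, because for `d ≥ 2` they share an edge and all edges of a shape regular simplex have
about the length of its diameter. The face `F` is found by passing from the largest element of the
star to neighbouring elements through facets that contain `v`. If no boundary facet at `v` were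
reached in this way, the elements that are reached would cover a neighbourhood of `v`
(`exists_reachable_surfaceFaces`): a segment in a small ball about `v` that avoids the simplices of
dimension less than `d - 1`, as a generic one does, can leave an element only through the relative
interior of a facet, and there it enters the element on the other side (`union_mem_nhds`). The
number of steps is at most the number of elements of the star, which is bounded because these
contain disjoint balls of comparable size after rescaling (`card_star_mul_le`).

Finally, on a boundary face `F` with vertex `v`, the number `z_v²` times the area of `F` is bounded
by a multiple of the integral of `u²` over `F` (`sq_mul_measure_le_setIntegral`), and every face is
chosen by at most `d` nodes. As different faces overlap in a null set, the integrals over the chosen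
faces add up to at most `d` times the integral over `Γ_h`.

The only consequence of quasi-uniformity that is needed is `IsChunky`: every element contains a ball
whose radius is a fixed multiple of its diameter.
-/

namespace BulkSurface

open Set Filter Topology

variable {d : ℕ}

/-- The Euclidean space `ℝ^d`. -/
abbrev Pt (d : ℕ) : Type := EuclideanSpace ℝ (Fin d)

/-! ### Barycentric coordinates of a full-dimensional simplex -/

/-- The finset `s` is the vertex set of a nondegenerate `d`-dimensional simplex in `ℝ^d`. -/
structure IsFullSimplex (s : Finset (Pt d)) : Prop where
  indep : AffineIndependent ℝ ((↑) : s → Pt d)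
  card : s.card = d + 1

namespace IsFullSimplex

variable {s : Finset (Pt d)}

/-- The vertices of a full-dimensional simplex, as an affine basis of `ℝ^d`. -/
noncomputable def basis (H : IsFullSimplex s) : AffineBasis s ℝ (Pt d) :=
  ⟨((↑) : s → Pt d), H.indep, by
    rw [H.indep.affineSpan_eq_top_iff_card_eq_finrank_add_one]
    simp [H.card]⟩

theorem range_basis (H : IsFullSimplex s) : range H.basis = (s : Set (Pt d)) := by
  change range ((↑) : s → Pt d) = _
  simp

open Classical in
/-- The barycentric coordinate that belongs to the point `v`, as an affine function on `ℝ^d`; it is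
zero by convention if `v` is not a vertex of the simplex. -/
noncomputable def bary (H : IsFullSimplex s) (v : Pt d) : Pt d →ᵃ[ℝ] ℝ :=
  if h : v ∈ s then H.basis.coord ⟨v, h⟩ else AffineMap.const ℝ _ 0

theorem bary_of_mem (H : IsFullSimplex s) {v : Pt d} (h : v ∈ s) :
    H.bary v = H.basis.coord ⟨v, h⟩ := by
  rw [bary, dif_pos h]

theorem bary_of_notMem (H : IsFullSimplex s) {v : Pt d} (h : v ∉ s) (x : Pt d) : H.bary v x = 0 := by
  rw [bary, dif_neg h]; rfl

theorem continuous_bary (H : IsFullSimplex s) (v : Pt d) : Continuous (H.bary v) :=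
  (H.bary v).continuous_of_finiteDimensional

theorem sum_bary (H : IsFullSimplex s) (x : Pt d) : ∑ v ∈ s, H.bary v x = 1 := by
  rw [← H.basis.sum_coord_apply_eq_one x, ← Finset.sum_attach]
  exact Finset.sum_congr rfl fun v _ => by rw [H.bary_of_mem v.2]

theorem sum_bary_smul (H : IsFullSimplex s) (x : Pt d) : ∑ v ∈ s, H.bary v x • v = x := by
  conv_rhs => rw [← H.basis.linear_combination_coord_eq_self x]
  rw [← Finset.sum_attach]
  exact Finset.sum_congr rfl fun v _ => by rw [H.bary_of_mem v.2]; rfl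

open Classical in
theorem bary_vertex (H : IsFullSimplex s) {u : Pt d} (hu : u ∈ s) (v : Pt d) :
    H.bary v u = if v = u then 1 else 0 := by
  by_cases hv : v ∈ s
  · rw [H.bary_of_mem hv]
    have h := H.basis.coord_apply ⟨v, hv⟩ ⟨u, hu⟩
    simp only [Subtype.mk.injEq] at h
    exact h
  · rw [H.bary_of_notMem hv, if_neg]
    rintro rfl
    exact hv hu

/-- An affine function is determined by its values at the vertices. -/
theorem apply_eq_sum (H : IsFullSimplex s) (f : Pt d →ᵃ[ℝ] ℝ) (x : Pt d) :
    f x = ∑ v ∈ s, H.bary v x * f v := by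
  have h : x = s.affineCombination ℝ id (fun v => H.bary v x) := by
    rw [Finset.affineCombination_eq_linear_combination _ _ _ (H.sum_bary x)]
    exact (H.sum_bary_smul x).symm
  conv_lhs => rw [h, Finset.map_affineCombination _ _ _ (H.sum_bary x),
    Finset.affineCombination_eq_linear_combination _ _ _ (H.sum_bary x)]
  rfl

theorem mem_convexHull_iff (H : IsFullSimplex s) {x : Pt d} :
    x ∈ convexHull ℝ (s : Set (Pt d)) ↔ ∀ v ∈ s, 0 ≤ H.bary v x := by
  rw [← H.range_basis, H.basis.convexHull_eq_nonneg_coord]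
  refine ⟨fun h v hv => ?_, fun h i => ?_⟩
  · rw [H.bary_of_mem hv]; exact h _
  · have := h i.1 i.2
    rwa [H.bary_of_mem i.2] at this

theorem mem_interior_iff (H : IsFullSimplex s) {x : Pt d} :
    x ∈ interior (convexHull ℝ (s : Set (Pt d))) ↔ ∀ v ∈ s, 0 < H.bary v x := by
  rw [← H.range_basis, H.basis.interior_convexHull]
  refine ⟨fun h v hv => ?_, fun h i => ?_⟩
  · rw [H.bary_of_mem hv]; exact h _
  · have := h i.1 i.2
    rwa [H.bary_of_mem i.2] at this

theorem interior_nonempty (H : IsFullSimplex s) :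
    (interior (convexHull ℝ (s : Set (Pt d)))).Nonempty := by
  rw [← H.range_basis, interior_convexHull_nonempty_iff_affineSpan_eq_top]
  exact H.basis.tot

theorem isBarycentric (H : IsFullSimplex s) {x : Pt d} (hx : x ∈ convexHull ℝ (s : Set (Pt d))) :
    Triangulation.IsBarycentric s x (fun v => H.bary v x) :=
  ⟨H.mem_convexHull_iff.1 hx, fun _ hv => H.bary_of_notMem hv x, H.sum_bary x, H.sum_bary_smul x⟩

end IsFullSimplex

/-! ### Nodal basis functions as barycentric coordinates -/

namespace Triangulation

variable (T : Triangulation d) {s t : Finset (Pt d)} {x v : Pt d}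

theorem isFullSimplex (hs : s ∈ T.faces) (hc : s.card = d + 1) : IsFullSimplex s :=
  ⟨T.indep hs, hc⟩

theorem isBarycentric_nodalBasis (hs : s ∈ T.faces) (hx : x ∈ convexHull ℝ (s : Set (Pt d))) :
    IsBarycentric s x (fun v => T.nodalBasis v x) := by
  obtain ⟨w, hw⟩ := exists_isBarycentric hx
  have : (fun v => T.nodalBasis v x) = w := funext fun v => T.nodalBasis_eq hs hw v
  rwa [this]

theorem nodalBasis_eq_bary (hs : s ∈ T.faces) (H : IsFullSimplex s)
    (hx : x ∈ convexHull ℝ (s : Set (Pt d))) (v : Pt d) : T.nodalBasis v x = H.bary v x :=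
  T.nodalBasis_eq hs (H.isBarycentric hx) v

/-- The simplices that contain a point contain its carrier, the set of the nodes whose basis
functions are nonzero at this point. -/
theorem mem_of_nodalBasis_ne_zero (hs : s ∈ T.faces) (hx : x ∈ convexHull ℝ (s : Set (Pt d)))
    (hv : T.nodalBasis v x ≠ 0) : v ∈ s := by
  by_contra h
  exact hv ((T.isBarycentric_nodalBasis hs hx).2.1 v h)

theorem mem_bulk_iff : x ∈ T.bulk ↔ ∃ s ∈ T.faces, x ∈ convexHull ℝ (s : Set (Pt d)) :=
  Geometry.SimplicialComplex.mem_space_iff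

theorem exists_element_of_mem_bulk (hx : x ∈ T.bulk) :
    ∃ s ∈ T.faces, s.card = d + 1 ∧ x ∈ convexHull ℝ (s : Set (Pt d)) := by
  obtain ⟨s, hs, hxs⟩ := T.mem_bulk_iff.1 hx
  obtain ⟨t, ht, hst, hc⟩ := T.exists_element s hs
  exact ⟨t, ht, hc, convexHull_mono (by exact_mod_cast hst) hxs⟩

theorem convexHull_subset_bulk (hs : s ∈ T.faces) : convexHull ℝ (s : Set (Pt d)) ⊆ T.bulk :=
  fun _ hx => T.mem_bulk_iff.2 ⟨s, hs, hx⟩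

theorem isCompact_convexHull (s : Finset (Pt d)) : IsCompact (convexHull ℝ (s : Set (Pt d))) :=
  s.finite_toSet.isCompact_convexHull ℝ

theorem isCompact_bulk : IsCompact T.bulk := by
  rw [bulk, Geometry.SimplicialComplex.space]
  exact T.finite_faces.isCompact_biUnion fun s _ => isCompact_convexHull s

theorem surface_subset_bulk : T.surface ⊆ T.bulk :=
  T.isCompact_bulk.isClosed.frontier_subset

theorem isCompact_surface : IsCompact T.surface :=
  T.isCompact_bulk.of_isClosed_subset isClosed_frontier T.surface_subset_bulk

theorem mem_surface_iff (hx : x ∈ T.bulk) : x ∈ T.surface ↔ x ∉ interior T.bulk := by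
  rw [surface, T.isCompact_bulk.isClosed.frontier_eq]
  simp [hx]

theorem nodalBasis_nonneg (hx : x ∈ T.bulk) (v : Pt d) : 0 ≤ T.nodalBasis v x := by
  obtain ⟨s, hs, hxs⟩ := T.mem_bulk_iff.1 hx
  have h := T.isBarycentric_nodalBasis hs hxs
  by_cases hv : v ∈ s
  · exact h.1 v hv
  · exact (h.2.1 v hv).ge

theorem sum_nodalBasis_le_one (hx : x ∈ T.bulk) (A : Finset (Pt d)) :
    ∑ v ∈ A, T.nodalBasis v x ≤ 1 := by
  classical
  obtain ⟨s, hs, hxs⟩ := T.mem_bulk_iff.1 hx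
  have h := T.isBarycentric_nodalBasis hs hxs
  calc ∑ v ∈ A, T.nodalBasis v x ≤ ∑ v ∈ A ∪ s, T.nodalBasis v x :=
        Finset.sum_le_sum_of_subset_of_nonneg Finset.subset_union_left
          fun v _ _ => T.nodalBasis_nonneg hx v
    _ = ∑ v ∈ s, T.nodalBasis v x :=
        (Finset.sum_subset Finset.subset_union_right fun v _ hv => h.2.1 v hv).symm
    _ = 1 := h.2.2.1

theorem nodalBasis_le_one (hx : x ∈ T.bulk) (v : Pt d) : T.nodalBasis v x ≤ 1 := by
  simpa using T.sum_nodalBasis_le_one hx {v}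

end Triangulation

/-! ### Boundary facets and the star of a boundary node -/

theorem volume_affineSpan_eq_zero {A : Finset (Pt d)} (hA : A.card ≤ d) :
    MeasureTheory.volume (affineSpan ℝ (A : Set (Pt d)) : Set (Pt d)) = 0 := by
  classical
  refine MeasureTheory.Measure.addHaar_affineSubspace _ _ fun h => ?_
  have h1 : vectorSpan ℝ (A : Set (Pt d)) = ⊤ := by
    rw [← direction_affineSpan, h, AffineSubspace.direction_top]
  rcases A.eq_empty_or_nonempty with rfl | hne
  · rw [Finset.coe_empty, AffineSubspace.span_empty] at h
    exact AffineSubspace.bot_ne_top ℝ (Pt d) (Pt d) h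
  · obtain ⟨n, hn⟩ := Nat.exists_eq_succ_of_ne_zero (Finset.card_ne_zero.2 hne)
    have h2 := finrank_vectorSpan_image_finset_le ℝ id A hn
    rw [Finset.image_id, h1, finrank_top, finrank_euclideanSpace_fin] at h2
    omega

namespace Triangulation

variable (T : Triangulation d) {s t F : Finset (Pt d)} {p v : Pt d}

/-- Two elements with a common facet `F` lie on different sides of `F`, so that together they cover
a neighbourhood of every point in the relative interior of `F`. -/
theorem union_mem_nhds (hs : s ∈ T.faces) (hsc : s.card = d + 1) (ht : t ∈ T.faces)
    (htc : t.card = d + 1) (hst : s ≠ t) (hFs : F ⊆ s) (hFt : F ⊆ t) (hFc : F.card = d)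
    (hp : p ∈ convexHull ℝ (F : Set (Pt d))) (hpos : ∀ w ∈ F, 0 < T.nodalBasis w p) :
    convexHull ℝ (s : Set (Pt d)) ∪ convexHull ℝ (t : Set (Pt d)) ∈ 𝓝 p := by
  classical
  have Hs := T.isFullSimplex hs hsc
  have Ht := T.isFullSimplex ht htc
  have hps : p ∈ convexHull ℝ (s : Set (Pt d)) := convexHull_mono (by exact_mod_cast hFs) hp
  have hpt : p ∈ convexHull ℝ (t : Set (Pt d)) := convexHull_mono (by exact_mod_cast hFt) hp
  obtain ⟨a, haF, rfl⟩ := Finset.exists_eq_insert_iff.2 ⟨hFs, by omega⟩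
  obtain ⟨b, hbF, rfl⟩ := Finset.exists_eq_insert_iff.2 ⟨hFt, by omega⟩
  have hab : a ≠ b := by rintro rfl; exact hst rfl
  have has : a ∈ insert a F := Finset.mem_insert_self a F
  have hbt : b ∈ insert b F := Finset.mem_insert_self b F
  have hps0 : ∀ w ∈ F, 0 < Hs.bary w p := fun w hw => by
    rw [← T.nodalBasis_eq_bary hs Hs hps]; exact hpos w hw
  have hpt0 : ∀ w ∈ F, 0 < Ht.bary w p := fun w hw => by
    rw [← T.nodalBasis_eq_bary ht Ht hpt]; exact hpos w hw
  have hap : Hs.bary a p = 0 := by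
    rw [← T.nodalBasis_eq_bary hs Hs hps]
    by_contra h
    rcases Finset.mem_insert.1 (T.mem_of_nodalBasis_ne_zero ht hpt h) with h | h
    · exact hab h
    · exact haF h
  -- The coordinates of the two opposite vertices are proportional, as both vanish on `F`.
  have hfac : ∀ x, Ht.bary b x = Hs.bary a x * Ht.bary b a := fun x => by
    rw [Hs.apply_eq_sum (Ht.bary b) x, Finset.sum_eq_single_of_mem a has]
    intro w hw hwa
    have hwF : w ∈ F := (Finset.mem_insert.1 hw).resolve_left hwa
    have hwb : b ≠ w := by rintro rfl; exact hbF hwF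
    rw [Ht.bary_vertex (hFt hwF), if_neg hwb, mul_zero]
  have hev : ∀ᶠ x in 𝓝 p, (∀ w ∈ F, 0 < Hs.bary w x) ∧ ∀ w ∈ F, 0 < Ht.bary w x := by
    refine Filter.Eventually.and ?_ ?_
    · rw [Filter.eventually_all_finset]
      exact fun w hw => (Hs.continuous_bary w).continuousAt.eventually_const_lt (hps0 w hw)
    · rw [Filter.eventually_all_finset]
      exact fun w hw => (Ht.continuous_bary w).continuousAt.eventually_const_lt (hpt0 w hw)
  have hneg : Ht.bary b a < 0 := by
    by_contra! hge
    -- Otherwise points close to `p` and above `F` would lie in both elements.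
    have hline : Tendsto (fun ε : ℝ => AffineMap.lineMap p a ε) (𝓝[>] 0) (𝓝 p) := by
      have h : Continuous (fun ε : ℝ => AffineMap.lineMap p a ε) := AffineMap.lineMap_continuous
      simpa using (h.tendsto 0).mono_left nhdsWithin_le_nhds
    obtain ⟨ε, ⟨h1, h2⟩, hε⟩ := ((hline.eventually hev).and self_mem_nhdsWithin).exists
    have hε : 0 < ε := hε
    have ha : Hs.bary a (AffineMap.lineMap p a ε) = ε := by
      rw [AffineMap.apply_lineMap, hap, Hs.bary_vertex has, if_pos rfl]
      simp [AffineMap.lineMap_apply]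
    have hms : AffineMap.lineMap p a ε ∈ convexHull ℝ ((insert a F : Finset (Pt d)) : Set (Pt d)) :=
      Hs.mem_convexHull_iff.2 fun w hw => by
        rcases Finset.mem_insert.1 hw with rfl | hw
        · rw [ha]; exact hε.le
        · exact (h1 w hw).le
    have hmt : AffineMap.lineMap p a ε ∈ convexHull ℝ ((insert b F : Finset (Pt d)) : Set (Pt d)) :=
      Ht.mem_convexHull_iff.2 fun w hw => by
        rcases Finset.mem_insert.1 hw with rfl | hw
        · rw [hfac, ha]; exact mul_nonneg hε.le hge
        · exact (h2 w hw).le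
    have hne : T.nodalBasis a (AffineMap.lineMap p a ε) ≠ 0 := by
      rw [T.nodalBasis_eq_bary hs Hs hms, ha]; exact hε.ne'
    rcases Finset.mem_insert.1 (T.mem_of_nodalBasis_ne_zero ht hmt hne) with h | h
    · exact hab h
    · exact haF h
  filter_upwards [hev] with x ⟨h1, h2⟩
  rcases le_or_gt 0 (Hs.bary a x) with h | h
  · refine Or.inl (Hs.mem_convexHull_iff.2 fun w hw => ?_)
    rcases Finset.mem_insert.1 hw with rfl | hw
    · exact h
    · exact (h1 w hw).le
  · refine Or.inr (Ht.mem_convexHull_iff.2 fun w hw => ?_)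
    rcases Finset.mem_insert.1 hw with rfl | hw
    · rw [hfac]; exact (mul_pos_of_neg_of_neg h hneg).le
    · exact (h2 w hw).le

/-- A facet of a single element lies on the boundary. -/
theorem convexHull_subset_surface (hs : s ∈ T.faces) (hsc : s.card = d + 1) (hFs : F ⊆ s)
    (hFc : F.card = d) (huniq : ∀ t ∈ T.faces, t.card = d + 1 → F ⊆ t → t = s) :
    convexHull ℝ (F : Set (Pt d)) ⊆ T.surface := by
  classical
  intro x hx
  have hFne : F.Nonempty := by
    rw [← Finset.coe_nonempty, ← convexHull_nonempty_iff (𝕜 := ℝ)]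
    exact ⟨x, hx⟩
  have Hs := T.isFullSimplex hs hsc
  have hFcs : convexHull ℝ (F : Set (Pt d)) ⊆ convexHull ℝ (s : Set (Pt d)) :=
    convexHull_mono (by exact_mod_cast hFs)
  have hF : F ∈ T.faces := T.toSimplicialComplex.down_closed hs hFs hFne
  rw [T.mem_surface_iff (T.convexHull_subset_bulk hs (hFcs hx))]
  intro hint
  -- A point `q` in the relative interior of `F` that is also an interior point of the bulk.
  obtain ⟨q, hqF, hqpos, hqint⟩ : ∃ q ∈ convexHull ℝ (F : Set (Pt d)),
      (∀ w ∈ F, 0 < Hs.bary w q) ∧ q ∈ interior T.bulk := by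
    have hd : (0 : ℝ) < F.card := by exact_mod_cast hFne.card_pos
    set w₀ : Pt d → ℝ := fun v => if v ∈ F then (F.card : ℝ)⁻¹ else 0 with hw₀
    have hm : IsBarycentric F (∑ v ∈ F, w₀ v • v) w₀ := by
      refine ⟨fun v hv => ?_, fun v hv => by simp [hw₀, hv], ?_, rfl⟩
      · simp only [hw₀, hv, if_true]; positivity
      · rw [Finset.sum_congr rfl fun v hv => if_pos hv]
        simp [hd.ne']
    set m := ∑ v ∈ F, w₀ v • v
    have hmpos : ∀ w ∈ F, 0 < Hs.bary w m := fun w hw => by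
      rw [← T.nodalBasis_eq_bary hs Hs (hFcs hm.mem_convexHull), T.nodalBasis_eq hF hm]
      simp only [hw₀, hw, if_true]; positivity
    have hline : Tendsto (fun ε : ℝ => AffineMap.lineMap x m ε) (𝓝[>] 0) (𝓝 x) := by
      have h : Continuous (fun ε : ℝ => AffineMap.lineMap x m ε) := AffineMap.lineMap_continuous
      simpa using (h.tendsto 0).mono_left nhdsWithin_le_nhds
    have h01 : ∀ᶠ ε : ℝ in 𝓝[>] 0, ε ∈ Ioc (0 : ℝ) 1 :=
      Ioc_mem_nhdsGT (zero_lt_one)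
    obtain ⟨ε, h1, h2⟩ :=
      ((hline.eventually (isOpen_interior.mem_nhds hint)).and h01).exists
    refine ⟨AffineMap.lineMap x m ε, ?_, fun w hw => ?_, h1⟩
    · exact (convex_convexHull ℝ _).lineMap_mem hx hm.mem_convexHull ⟨h2.1.le, h2.2⟩
    · have h3 := Hs.mem_convexHull_iff.1 (hFcs hx) w (hFs hw)
      rw [AffineMap.apply_lineMap, AffineMap.lineMap_apply_ring']
      have h4 := hmpos w hw
      nlinarith [h2.1, h2.2, mul_pos h2.1 h4, mul_nonneg (sub_nonneg.2 h2.2) h3]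
  have hqs := hFcs hqF
  obtain ⟨a, haF, rfl⟩ := Finset.exists_eq_insert_iff.2 ⟨hFs, by omega⟩
  have has : a ∈ insert a F := Finset.mem_insert_self a F
  have haq : Hs.bary a q = 0 := by
    rw [← T.nodalBasis_eq_bary hs Hs hqs]
    by_contra h
    exact haF (T.mem_of_nodalBasis_ne_zero hF hqF h)
  -- Close to `q` there are only simplices that contain `q`.
  have hW : ∀ᶠ y in 𝓝 q, ∀ G ∈ T.faces, y ∈ convexHull ℝ (G : Set (Pt d)) →
      q ∈ convexHull ℝ (G : Set (Pt d)) := by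
    rw [T.finite_faces.eventually_all]
    intro G _
    by_cases hq : q ∈ convexHull ℝ (G : Set (Pt d))
    · exact .of_forall fun _ _ => hq
    · filter_upwards [(isCompact_convexHull G).isClosed.isOpen_compl.mem_nhds hq] with y hy hy'
      exact absurd hy' hy
  have hline : Tendsto (fun ε : ℝ => AffineMap.lineMap q a (-ε)) (𝓝[>] 0) (𝓝 q) := by
    have h : Continuous (fun ε : ℝ => AffineMap.lineMap q a (-ε)) :=
      AffineMap.lineMap_continuous.comp continuous_neg
    simpa using (h.tendsto 0).mono_left nhdsWithin_le_nhds
  obtain ⟨ε, ⟨h1, h2⟩, hε⟩ := ((hline.eventually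
    (hW.and (isOpen_interior.mem_nhds hqint))).and self_mem_nhdsWithin).exists
  have hε : 0 < ε := hε
  obtain ⟨G, hG, hGc, hyG⟩ := T.exists_element_of_mem_bulk (interior_subset h2)
  have hqG := h1 G hG hyG
  have hFG : F ⊆ G := fun w hw => T.mem_of_nodalBasis_ne_zero hG hqG (by
    rw [T.nodalBasis_eq_bary hs Hs hqs]; exact (hqpos w hw).ne')
  obtain rfl := huniq G hG hGc hFG
  have h3 := Hs.mem_convexHull_iff.1 hyG a has
  rw [AffineMap.apply_lineMap, haq, Hs.bary_vertex has, if_pos rfl,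
    AffineMap.lineMap_apply_ring'] at h3
  linarith

/-- The elements that contain the point `v`. -/
def Star (v : Pt d) : Type := {s : Finset (Pt d) // s ∈ T.faces ∧ s.card = d + 1 ∧ v ∈ s}

/-- Two elements of the star of `v` are adjacent if they have a facet in common. -/
def starGraph (v : Pt d) : SimpleGraph (T.Star v) where
  Adj s t := s ≠ t ∧ ∃ F, F ⊆ s.1 ∧ F ⊆ t.1 ∧ F.card = d
  symm := ⟨fun _ _ ⟨h, F, h1, h2, h3⟩ => ⟨h.symm, F, h2, h1, h3⟩⟩
  loopless := ⟨fun _ h => h.1 rfl⟩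

instance (v : Pt d) : Finite (T.Star v) := by
  have := T.finite_faces.to_subtype
  exact Finite.of_injective (fun s : T.Star v => (⟨s.1, s.2.1⟩ : T.faces)) fun s t h =>
    Subtype.ext (congrArg (fun s : T.faces => s.1) h)

/-- Every element that contains a boundary node `v` is connected, within the star of `v` and through
common facets, with an element that has a boundary facet through `v`. Otherwise the union of the
elements that are connected with it would be a neighbourhood of `v`: a segment in a small ball about
`v` that avoids all simplices of dimension less than `d - 1` cannot leave this union. -/
theorem exists_reachable_surfaceFaces (hv : v ∈ T.surface) (s : T.Star v) :
    ∃ t, (T.starGraph v).Reachable s t ∧ ∃ F ∈ T.surfaceFaces, F ⊆ t.1 ∧ v ∈ F := by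
  classical
  by_contra! hcon
  set K : Set (T.Star v) := {t | (T.starGraph v).Reachable s t} with hK
  set U : Set (Pt d) := ⋃ t ∈ K, convexHull ℝ (t.1 : Set (Pt d)) with hU
  have hUclosed : IsClosed U :=
    (Set.toFinite K).isClosed_biUnion fun t _ => (isCompact_convexHull t.1).isClosed
  have hUbulk : U ⊆ T.bulk := iUnion₂_subset fun t _ => T.convexHull_subset_bulk t.2.1
  have hsub : ∀ t ∈ K, convexHull ℝ (t.1 : Set (Pt d)) ⊆ U := fun t ht =>
    subset_biUnion_of_mem (u := fun t : T.Star v => convexHull ℝ (t.1 : Set (Pt d))) ht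
  have hvbulk := T.surface_subset_bulk hv
  -- In a small ball about `v`, the basis function of `v` is positive on the elements of the star,
  -- so that the carrier of every point there contains `v`.
  obtain ⟨ε, hε, hball⟩ : ∃ ε > 0, ∀ x ∈ Metric.ball v ε, ∀ t : T.Star v,
      x ∈ convexHull ℝ (t.1 : Set (Pt d)) → 0 < T.nodalBasis v x := by
    have : ∀ᶠ x in 𝓝 v, ∀ t : T.Star v,
        x ∈ convexHull ℝ (t.1 : Set (Pt d)) → 0 < T.nodalBasis v x := by
      rw [Filter.eventually_all]
      intro t
      have H := T.isFullSimplex t.2.1 t.2.2.1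
      have h1 : 0 < H.bary v v := by rw [H.bary_vertex t.2.2.2, if_pos rfl]; exact one_pos
      filter_upwards [(H.continuous_bary v).continuousAt.eventually_const_lt h1] with x hx hxt
      rwa [T.nodalBasis_eq_bary t.2.1 H hxt]
    obtain ⟨ε, hε, h⟩ := Metric.eventually_nhds_iff_ball.1 this
    exact ⟨ε, hε, h⟩
  refine (T.mem_surface_iff hvbulk).1 hv (mem_interior.2
    ⟨Metric.ball v ε, fun x hx => hUbulk ?_, Metric.isOpen_ball, Metric.mem_ball_self hε⟩)
  -- A generic starting point `y` of a segment that ends at `x`.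
  obtain ⟨y, hys, hyball, hygen⟩ : ∃ y ∈ convexHull ℝ (s.1 : Set (Pt d)), y ∈ Metric.ball v ε ∧
      ∀ G ∈ T.faces, G.card < d → y ∉ affineSpan ℝ ((insert x G : Finset (Pt d)) : Set (Pt d)) := by
    have H := T.isFullSimplex s.2.1 s.2.2.1
    set O := interior (convexHull ℝ (s.1 : Set (Pt d))) ∩ Metric.ball v ε with hO
    have hOopen : IsOpen O := isOpen_interior.inter Metric.isOpen_ball
    have hvcl : v ∈ closure (interior (convexHull ℝ (s.1 : Set (Pt d)))) := by
      rw [(convex_convexHull ℝ _).closure_interior_eq_closure_of_nonempty_interior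
        H.interior_nonempty]
      exact subset_closure (subset_convexHull ℝ _ s.2.2.2)
    have hOne : O.Nonempty := by
      have := mem_closure_iff.1 hvcl _ Metric.isOpen_ball (Metric.mem_ball_self hε)
      rwa [inter_comm] at this
    have hnull : MeasureTheory.volume (⋃ G ∈ {G | G ∈ T.faces ∧ G.card < d},
        (affineSpan ℝ ((insert x G : Finset (Pt d)) : Set (Pt d)) : Set (Pt d))) = 0 := by
      rw [MeasureTheory.measure_biUnion_null_iff
        (T.finite_faces.subset fun G hG => hG.1).countable]
      intro G hG
      exact volume_affineSpan_eq_zero ((Finset.card_insert_le x G).trans hG.2)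
    have hpos := hOopen.measure_pos MeasureTheory.volume hOne
    obtain ⟨y, hy, hy'⟩ : (O \ ⋃ G ∈ {G | G ∈ T.faces ∧ G.card < d},
        (affineSpan ℝ ((insert x G : Finset (Pt d)) : Set (Pt d)) : Set (Pt d))).Nonempty := by
      refine MeasureTheory.nonempty_of_measure_ne_zero (μ := MeasureTheory.volume) ?_
      rw [MeasureTheory.measure_sdiff_null hnull]
      exact hpos.ne'
    refine ⟨y, interior_subset hy.1, hy.2, fun G hG hGc h => hy' ?_⟩
    exact mem_biUnion (x := G) (show G ∈ {G | G ∈ T.faces ∧ G.card < d} from ⟨hG, hGc⟩) h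
  set γ : ℝ → Pt d := fun τ => AffineMap.lineMap y x τ with hγ
  have hγc : Continuous γ := AffineMap.lineMap_continuous
  have key : Icc (0 : ℝ) 1 ⊆ γ ⁻¹' U := by
    refine IsClosed.Icc_subset_of_forall_mem_nhdsWithin
      ((hUclosed.preimage hγc).inter isClosed_Icc) ?_ ?_
    · have : γ 0 = y := by simp [hγ]
      rw [mem_preimage, this]
      exact hsub s (SimpleGraph.Reachable.refl s) hys
    · rintro τ ⟨hτU, hτ0, hτ1⟩
      refine nhdsWithin_le_nhds (hγc.continuousAt.preimage_mem_nhds ?_)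
      obtain ⟨t, htK, hpt⟩ := mem_iUnion₂.1 hτU
      set p := γ τ with hp
      have hpball : p ∈ Metric.ball v ε :=
        (convex_ball v ε).lineMap_mem hyball hx ⟨hτ0, hτ1.le⟩
      have Ht := T.isFullSimplex t.2.1 t.2.2.1
      have hbar := T.isBarycentric_nodalBasis t.2.1 hpt
      set F := t.1.filter (fun w => 0 < T.nodalBasis w p) with hF
      have hFt : F ⊆ t.1 := Finset.filter_subset _ _
      have hFpos : ∀ w ∈ F, 0 < T.nodalBasis w p := fun w hw => (Finset.mem_filter.1 hw).2
      have hvF : v ∈ F := Finset.mem_filter.2 ⟨t.2.2.2, hball p hpball t hpt⟩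
      have hFface : F ∈ T.faces := T.toSimplicialComplex.down_closed t.2.1 hFt ⟨v, hvF⟩
      have hF0 : ∀ w, w ∉ F → T.nodalBasis w p = 0 := by
        intro w hw
        by_contra h
        have hwt := T.mem_of_nodalBasis_ne_zero t.2.1 hpt h
        exact hw (Finset.mem_filter.2 ⟨hwt, lt_of_le_of_ne (hbar.1 w hwt) (Ne.symm h)⟩)
      have hpF : p ∈ convexHull ℝ (F : Set (Pt d)) := by
        refine IsBarycentric.mem_convexHull (w := fun w => T.nodalBasis w p)
          ⟨fun w hw => (hFpos w hw).le, hF0, ?_, ?_⟩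
        · rw [← hbar.2.2.1]
          exact Finset.sum_subset hFt fun w _ hw => hF0 w hw
        · refine Eq.trans ?_ hbar.2.2.2
          exact Finset.sum_subset hFt fun w _ hw => by simp [hF0 w hw]
      rcases lt_trichotomy F.card d with hlt | heq | hgt
      · -- The segment avoids simplices of low dimension, since `y` is generic.
        exfalso
        refine hygen F hFface hlt ?_
        have hpx : p ∈ affineSpan ℝ ((insert x F : Finset (Pt d)) : Set (Pt d)) :=
          affineSpan_mono ℝ (by simp) (convexHull_subset_affineSpan _ hpF)
        have hxx : x ∈ affineSpan ℝ ((insert x F : Finset (Pt d)) : Set (Pt d)) :=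
          subset_affineSpan ℝ _ (by simp)
        have h1 : 1 - τ ≠ 0 := by linarith
        have hy : y = AffineMap.lineMap x p (1 - τ)⁻¹ := by
          have hpe : p = y + τ • (x - y) := by
            rw [hp, hγ]; simp [AffineMap.lineMap_apply, add_comm]
          have h2 : p - x = (1 - τ) • (y - x) := by rw [hpe]; module
          rw [AffineMap.lineMap_apply, vsub_eq_sub, h2, smul_smul, inv_mul_cancel₀ h1, one_smul,
            vadd_eq_add, sub_add_cancel]
        rw [hy]
        exact AffineMap.lineMap_mem _ hxx hpx
      · -- The facet `F` is not a boundary facet, hence a facet of a second element.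
        obtain ⟨t', ht', ht'c, hFt', hne⟩ : ∃ t' ∈ T.faces, t'.card = d + 1 ∧ F ⊆ t' ∧ t' ≠ t.1 := by
          by_contra! h
          exact hcon t htK F ⟨hFface, heq,
            T.convexHull_subset_surface t.2.1 t.2.2.1 hFt heq h⟩ hFt hvF
        let r : T.Star v := ⟨t', ht', ht'c, hFt' hvF⟩
        have hadj : (T.starGraph v).Adj t r :=
          ⟨fun h => hne (congrArg Subtype.val h).symm, F, hFt, hFt', heq⟩
        have hrK : r ∈ K := SimpleGraph.Reachable.trans htK hadj.reachable
        exact Filter.mem_of_superset (T.union_mem_nhds t.2.1 t.2.2.1 ht' ht'c hne.symm hFt hFt' heq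
          hpF hFpos) (union_subset (hsub t htK) (hsub r hrK))
      · have hFeq : F = t.1 := Finset.eq_of_subset_of_card_le hFt (by rw [t.2.2.1]; omega)
        have hint : p ∈ interior (convexHull ℝ (t.1 : Set (Pt d))) := by
          rw [Ht.mem_interior_iff]
          intro w hw
          rw [← T.nodalBasis_eq_bary t.2.1 Ht hpt]
          exact hFpos w (hFeq ▸ hw)
        exact Filter.mem_of_superset (mem_interior_iff_mem_nhds.1 hint) (hsub t htK)
  have h1 := key (right_mem_Icc.2 zero_le_one)
  simpa [hγ] using h1

end Triangulation

/-! ### Shape regularity -/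

/-- The volume of the unit ball in `ℝ^d`. -/
noncomputable def unitBallVolume (d : ℕ) : ℝ :=
  MeasureTheory.volume.real (Metric.ball (0 : Pt d) 1)

theorem unitBallVolume_pos (d : ℕ) : 0 < unitBallVolume d :=
  ENNReal.toReal_pos (Metric.measure_ball_pos _ _ one_pos).ne'
    MeasureTheory.measure_ball_lt_top.ne

theorem volume_real_ball (x : Pt d) {r : ℝ} (hr : 0 < r) :
    MeasureTheory.volume.real (Metric.ball x r) = r ^ d * unitBallVolume d := by
  rw [MeasureTheory.measureReal_def, MeasureTheory.Measure.addHaar_ball_of_pos _ x hr,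
    ENNReal.toReal_mul, ENNReal.toReal_ofReal (by positivity), finrank_euclideanSpace_fin]
  rfl

theorem volume_real_closedBall (x : Pt d) {r : ℝ} (hr : 0 ≤ r) :
    MeasureTheory.volume.real (Metric.closedBall x r) = r ^ d * unitBallVolume d := by
  rw [MeasureTheory.Measure.addHaar_real_closedBall _ x hr, finrank_euclideanSpace_fin]
  rfl

/-- The simplex with vertex set `s` contains a ball whose radius is `κ` times its diameter. -/
def IsChunky (κ : ℝ) (s : Finset (Pt d)) : Prop :=
  ∃ c, Metric.closedBall c (κ * Metric.diam (s : Set (Pt d))) ⊆ convexHull ℝ (s : Set (Pt d))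

theorem dist_le_diam {s : Finset (Pt d)} {x y : Pt d} (hx : x ∈ convexHull ℝ (s : Set (Pt d)))
    (hy : y ∈ convexHull ℝ (s : Set (Pt d))) : dist x y ≤ Metric.diam (s : Set (Pt d)) := by
  rw [← convexHull_diam]
  exact Metric.dist_le_diam_of_mem (Triangulation.isCompact_convexHull s).isBounded hx hy

theorem diam_pos {s : Finset (Pt d)} (h : 1 < s.card) : 0 < Metric.diam (s : Set (Pt d)) := by
  obtain ⟨u, hu, w, hw, huw⟩ := Finset.one_lt_card.1 h
  exact (dist_pos.2 huw).trans_le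
    (dist_le_diam (subset_convexHull ℝ _ hu) (subset_convexHull ℝ _ hw))

/-- The signed distance to a facet is a 1-Lipschitz function. -/
theorem abs_signedInfDist_sub_le [NeZero d] (S : Affine.Simplex ℝ (Pt d) d) (i : Fin (d + 1))
    (x y : Pt d) : |S.signedInfDist i x - S.signedInfDist i y| ≤ dist x y := by
  rw [Affine.Simplex.signedInfDist, AffineSubspace.signedInfDist_def, signedDist_triangle_left,
    dist_comm]
  exact abs_signedDist_le_dist _ _ _

namespace IsFullSimplex

variable {s F : Finset (Pt d)} {κ : ℝ}

theorem mem_convexHull_of_subset (H : IsFullSimplex s) (hF : F ⊆ s) {x : Pt d}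
    (h0 : ∀ v ∈ F, 0 ≤ H.bary v x) (h1 : ∀ v ∈ s, v ∉ F → H.bary v x = 0) :
    x ∈ convexHull ℝ (F : Set (Pt d)) := by
  have h2 : ∀ v, v ∉ F → H.bary v x = 0 := fun v hv => by
    by_cases hvs : v ∈ s
    · exact h1 v hvs hv
    · exact H.bary_of_notMem hvs x
  refine Triangulation.IsBarycentric.mem_convexHull (w := fun v => H.bary v x) ⟨h0, h2, ?_, ?_⟩
  · rw [← H.sum_bary x]
    exact Finset.sum_subset hF fun v _ hv => h2 v hv
  · refine Eq.trans ?_ (H.sum_bary_smul x)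
    exact Finset.sum_subset hF fun v _ hv => by simp [h2 v hv]

theorem bary_le_one (H : IsFullSimplex s) {x : Pt d} (hx : x ∈ convexHull ℝ (s : Set (Pt d)))
    {v : Pt d} (hv : v ∈ s) : H.bary v x ≤ 1 := by
  rw [← H.sum_bary x]
  exact Finset.single_le_sum (f := fun v => H.bary v x) (H.mem_convexHull_iff.1 hx) hv

/-- The incenter and the inradius of a simplex belong to a ball inside the simplex. -/
theorem closedBall_incenter_subset [NeZero d] (H : IsFullSimplex s)
    (S : Affine.Simplex ℝ (Pt d) d) (hS : (s : Set (Pt d)) = range S.points) :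
    Metric.closedBall S.incenter S.inradius ⊆ convexHull ℝ (s : Set (Pt d)) := by
  classical
  intro x hx
  refine H.mem_convexHull_iff.2 fun v hv => ?_
  obtain ⟨i, rfl⟩ : v ∈ range S.points := hS ▸ hv
  set f : Pt d →ᵃ[ℝ] ℝ := (S.signedInfDist i).toAffineMap with hf
  have hfac : ∀ y, f y = H.bary (S.points i) y * f (S.points i) := fun y => by
    rw [H.apply_eq_sum f y, Finset.sum_eq_single_of_mem _ hv]
    intro w hw hwi
    obtain ⟨j, rfl⟩ : w ∈ range S.points := hS ▸ hw
    have h : f (S.points j) = 0 :=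
      S.signedInfDist_apply_of_ne fun h => hwi (by rw [h])
    rw [h, mul_zero]
  have hc : f S.incenter = S.inradius := S.signedInfDist_incenter i
  have hfi : 0 ≤ f (S.points i) := by
    have : f (S.points i) = _ := S.signedInfDist_apply_self i
    rw [this]; positivity
  have hfi : 0 < f (S.points i) := by
    refine lt_of_le_of_ne hfi fun h => ?_
    have := hfac S.incenter
    rw [← h, mul_zero, hc] at this
    exact S.inradius_pos.ne' this
  have hfx : 0 ≤ f x := by
    have h1 : |f x - f S.incenter| ≤ dist x S.incenter := abs_signedInfDist_sub_le S i x S.incenter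
    have h2 := (abs_le.1 h1).1
    have h3 := Metric.mem_closedBall.1 hx
    linarith
  rw [hfac] at hfx
  exact nonneg_of_mul_nonneg_left hfx hfi

theorem exists_simplex (H : IsFullSimplex s) :
    ∃ S : Affine.Simplex ℝ (Pt d) d, (s : Set (Pt d)) = range S.points := by
  let e := (s.equivFinOfCardEq H.card).symm
  refine ⟨⟨fun i => (e i : Pt d), H.indep.comp_embedding e.toEmbedding⟩, ?_⟩
  ext x
  refine ⟨fun hx => ⟨e.symm ⟨x, hx⟩, by simp⟩, ?_⟩
  rintro ⟨i, rfl⟩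
  exact (e i).2

/-- The edges of a chunky simplex are not much shorter than its diameter. -/
theorem mul_diam_le_dist (H : IsFullSimplex s) (hκ : 0 ≤ κ) (h : IsChunky κ s) {u w : Pt d}
    (hu : u ∈ s) (hw : w ∈ s) (huw : u ≠ w) :
    κ * Metric.diam (s : Set (Pt d)) ≤ dist u w := by
  classical
  obtain ⟨c, hc⟩ := h
  have h0 : 0 ≤ κ * Metric.diam (s : Set (Pt d)) := mul_nonneg hκ Metric.diam_nonneg
  have hd : 0 < dist u w := dist_pos.2 huw
  set τ := κ * Metric.diam (s : Set (Pt d)) / dist u w with hτ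
  have h1 : c ∈ convexHull ℝ (s : Set (Pt d)) := hc (Metric.mem_closedBall_self h0)
  have h2 : τ • (u - w) +ᵥ c ∈ convexHull ℝ (s : Set (Pt d)) := by
    refine hc (Metric.mem_closedBall.2 ?_)
    rw [vadd_eq_add, dist_add_self_left, norm_smul, ← dist_eq_norm, Real.norm_eq_abs,
      abs_of_nonneg (by positivity), hτ, div_mul_cancel₀ _ hd.ne']
  have h3 := H.bary_le_one h2 hu
  have h4 := H.mem_convexHull_iff.1 h1 u hu
  have h5 : (H.bary u).linear (u - w) = 1 := by
    have := (H.bary u).linearMap_vsub u w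
    rw [vsub_eq_sub, vsub_eq_sub, H.bary_vertex hu, H.bary_vertex hw, if_pos rfl, if_neg huw] at this
    simpa using this
  rw [AffineMap.map_vadd, map_smul, h5, vadd_eq_add, smul_eq_mul, mul_one] at h3
  have h6 : τ ≤ 1 := by linarith
  rwa [hτ, div_le_one hd] at h6

/-- The facets of a chunky simplex contain `(d - 1)`-dimensional balls of comparable size: the
cross-section of the simplex that is parallel to the facet and passes through the centre of the
given ball is a smaller homothetic copy of the facet. -/
theorem exists_ball_facet (H : IsFullSimplex s) (hd : 1 ≤ d) (hκ : 0 < κ) (h : IsChunky κ s)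
    (hF : F ⊆ s) (hFc : F.card = d) :
    ∃ q, ∀ w ∈ vectorSpan ℝ (F : Set (Pt d)), ‖w‖ ≤ κ * Metric.diam (s : Set (Pt d)) →
      w + q ∈ convexHull ℝ (F : Set (Pt d)) := by
  classical
  obtain ⟨c, hc⟩ := h
  have h0 : 0 < κ * Metric.diam (s : Set (Pt d)) :=
    mul_pos hκ (diam_pos (by rw [H.card]; omega))
  obtain ⟨a, haF, rfl⟩ := Finset.exists_eq_insert_iff.2 ⟨hF, by rw [H.card, hFc]⟩
  set δ := κ * Metric.diam (((insert a F : Finset (Pt d))) : Set (Pt d))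
  have has := Finset.mem_insert_self a F
  have hci : ∀ v ∈ insert a F, 0 < H.bary v c :=
    H.mem_interior_iff.1 (mem_interior_iff_mem_nhds.2
      (Filter.mem_of_superset (Metric.closedBall_mem_nhds c h0) hc))
  obtain ⟨b, hb⟩ : F.Nonempty := by rw [← Finset.card_pos, hFc]; exact hd
  have hca : H.bary a c < 1 := by
    have h1 := H.sum_bary c
    rw [Finset.sum_insert haF] at h1
    have h2 := Finset.single_le_sum (f := fun v => H.bary v c)
      (fun v hv => (hci v (Finset.mem_insert_of_mem hv)).le) hb
    have h3 := hci b (Finset.mem_insert_of_mem hb)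
    linarith
  have hca' : (1 - H.bary a c) ≠ 0 := by linarith
  set μ := (1 - H.bary a c)⁻¹ with hμ
  have hμ1 : 1 ≤ μ := (one_le_inv₀ (by linarith)).2 (by linarith [hci a has])
  -- The point `q` is the projection of the centre `c` from the vertex `a` to the facet.
  have hq : ∀ v, H.bary v (AffineMap.lineMap a c μ) = H.bary v a + μ * (H.bary v c - H.bary v a) :=
    fun v => by rw [AffineMap.apply_lineMap, AffineMap.lineMap_apply_ring']; ring
  refine ⟨AffineMap.lineMap a c μ, fun w hw hwn => ?_⟩
  have hadd : ∀ v x, H.bary v (w + x) = (H.bary v).linear w + H.bary v x := fun v x => by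
    rw [← vadd_eq_add, AffineMap.map_vadd, vadd_eq_add]
  have hcw : w + c ∈ convexHull ℝ ((insert a F : Finset (Pt d)) : Set (Pt d)) :=
    hc (Metric.mem_closedBall.2 (by rwa [dist_add_self_left]))
  refine H.mem_convexHull_of_subset hF (fun v hv => ?_) (fun v hv hvF => ?_)
  · have h1 := H.mem_convexHull_iff.1 hcw v (Finset.mem_insert_of_mem hv)
    have hva : v ≠ a := by rintro rfl; exact haF hv
    rw [hadd] at h1 ⊢
    rw [hq, H.bary_vertex has, if_neg hva]
    nlinarith [hci v (Finset.mem_insert_of_mem hv)]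
  · obtain rfl : v = a := (Finset.mem_insert.1 hv).resolve_right hvF
    have hlin : vectorSpan ℝ (F : Set (Pt d)) ≤ LinearMap.ker (H.bary v).linear := by
      rw [vectorSpan_def, Submodule.span_le]
      rintro _ ⟨x, hx, y, hy, rfl⟩
      have hvx : v ≠ x := by rintro rfl; exact hvF hx
      have hvy : v ≠ y := by rintro rfl; exact hvF hy
      rw [SetLike.mem_coe, LinearMap.mem_ker]
      refine ((H.bary v).linearMap_vsub x y).trans ?_
      rw [H.bary_vertex (Finset.mem_insert_of_mem hx), H.bary_vertex (Finset.mem_insert_of_mem hy),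
        if_neg hvx, if_neg hvy, vsub_self]
    rw [hadd, LinearMap.mem_ker.1 (hlin hw), hq, H.bary_vertex has, if_pos rfl, hμ]
    field_simp
    ring

end IsFullSimplex

namespace Triangulation

variable (T : Triangulation d) {s t F : Finset (Pt d)} {v : Pt d} {κ : ℝ}

theorem IsQuasiUniform.isChunky [NeZero d] {T : Triangulation d} {ϑ : ℝ} (hϑ : 0 < ϑ)
    (h : T.IsQuasiUniform ϑ) (hs : s ∈ T.faces) (hsc : s.card = d + 1) :
    IsChunky (2 * ϑ)⁻¹ s := by
  have H := T.isFullSimplex hs hsc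
  obtain ⟨S, hS⟩ := H.exists_simplex
  refine ⟨S.incenter, (Metric.closedBall_subset_closedBall ?_).trans
    (H.closedBall_incenter_subset S hS)⟩
  have h1 := h S ⟨s, hs, hS⟩
  have h2 : Metric.diam (s : Set (Pt d)) ≤ 2 * S.circumradius := by
    refine Metric.diam_le_of_forall_dist_le (by linarith [S.circumradius_nonneg]) ?_
    rw [hS]
    rintro _ ⟨i, rfl⟩ _ ⟨j, rfl⟩
    have := dist_triangle_right (S.points i) (S.points j) S.circumcenter
    rw [S.dist_circumcenter_eq_circumradius, S.dist_circumcenter_eq_circumradius] at this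
    linarith
  have h3 : 0 < S.circumradius := by
    refine lt_of_le_of_ne S.circumradius_nonneg fun h0 => ?_
    rw [← h0, div_zero] at h1
    exact absurd (inv_pos.2 hϑ) h1.not_gt
  rw [le_div_iff₀ h3] at h1
  calc (2 * ϑ)⁻¹ * Metric.diam (s : Set (Pt d)) ≤ (2 * ϑ)⁻¹ * (2 * S.circumradius) := by gcongr
    _ = ϑ⁻¹ * S.circumradius := by rw [mul_inv]; ring
    _ ≤ S.inradius := h1

theorem disjoint_interior (hs : s ∈ T.faces) (hsc : s.card = d + 1) (ht : t ∈ T.faces)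
    (htc : t.card = d + 1) (hst : s ≠ t) :
    Disjoint (interior (convexHull ℝ (s : Set (Pt d))))
      (interior (convexHull ℝ (t : Set (Pt d)))) := by
  rw [Set.disjoint_left]
  intro x hx hx'
  have H := T.isFullSimplex hs hsc
  refine hst (Finset.eq_of_subset_of_card_le (fun w hw => ?_) (by rw [hsc, htc]))
  refine T.mem_of_nodalBasis_ne_zero ht (interior_subset hx') ?_
  rw [T.nodalBasis_eq_bary hs H (interior_subset hx)]
  exact (H.mem_interior_iff.1 hx w hw).ne'

theorem exists_ball_subset (hd : 1 ≤ d) (hκ : 0 < κ) (h : IsChunky κ s) (hsc : s.card = d + 1)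
    (hv : v ∈ s) {ρ : ℝ} (hρ : 0 < ρ) (hρs : ρ ≤ Metric.diam (s : Set (Pt d))) :
    ∃ c, Metric.ball c (κ * ρ) ⊆
      interior (convexHull ℝ (s : Set (Pt d))) ∩ Metric.closedBall v ρ := by
  obtain ⟨c, hc⟩ := h
  have hδ : 0 < Metric.diam (s : Set (Pt d)) := diam_pos (by omega)
  set δ := Metric.diam (s : Set (Pt d))
  have hvs : v ∈ convexHull ℝ (s : Set (Pt d)) := subset_convexHull ℝ _ hv
  -- The image of the given ball under the homothety with centre `v` and ratio `ρ / δ`.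
  have key : ∀ x ∈ Metric.ball (v + (ρ / δ) • (c - v)) (κ * ρ),
      x ∈ convexHull ℝ (s : Set (Pt d)) ∧ dist x v ≤ ρ := by
    intro x hx
    set y := v + (δ / ρ) • (x - v) with hy
    have hxy : x = v + (ρ / δ) • (y - v) := by
      rw [hy, add_sub_cancel_left, smul_smul, div_mul_div_cancel₀ hδ.ne', div_self hρ.ne',
        one_smul, add_sub_cancel]
    have hyc : y - c = (δ / ρ) • (x - (v + (ρ / δ) • (c - v))) := by
      have h1 : (δ / ρ) * (ρ / δ) = 1 := by field_simp
      rw [← sub_sub, smul_sub, smul_smul, h1, one_smul, hy]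
      abel
    have hys : y ∈ convexHull ℝ (s : Set (Pt d)) := by
      refine hc (Metric.mem_closedBall.2 ?_)
      rw [Metric.mem_ball, dist_eq_norm] at hx
      rw [dist_eq_norm, hyc, norm_smul, Real.norm_eq_abs, abs_of_pos (by positivity)]
      calc δ / ρ * ‖x - (v + (ρ / δ) • (c - v))‖ ≤ δ / ρ * (κ * ρ) := by gcongr
        _ = κ * δ := by field_simp
    constructor
    · have h1 := (convex_convexHull ℝ (s : Set (Pt d))).lineMap_mem hvs hys
        (t := ρ / δ) ⟨by positivity, (div_le_one hδ).2 hρs⟩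
      rwa [AffineMap.lineMap_apply, vsub_eq_sub, vadd_eq_add, add_comm, ← hxy] at h1
    · have h1 : dist y v ≤ δ := dist_le_diam hys hvs
      rw [hxy, dist_self_add_left, norm_smul, ← dist_eq_norm, Real.norm_eq_abs,
        abs_of_pos (by positivity)]
      calc ρ / δ * dist y v ≤ ρ / δ * δ := by gcongr
        _ = ρ := by field_simp
  refine ⟨v + (ρ / δ) • (c - v), subset_inter ?_ fun x hx => (key x hx).2⟩
  exact Metric.isOpen_ball.subset_interior_iff.2 fun x hx => (key x hx).1

/-- The number of the elements that meet in a node is bounded in terms of their shape regularity: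
after rescaling they contain disjoint balls of the same size close to the node. -/
theorem card_star_mul_le (hd : 1 ≤ d) (hκ : 0 < κ)
    (hT : ∀ s ∈ T.faces, s.card = d + 1 → IsChunky κ s) (v : Pt d) :
    (Nat.card (T.Star v) : ℝ) * κ ^ d ≤ 1 := by
  classical
  have := Fintype.ofFinite (T.Star v)
  rcases isEmpty_or_nonempty (T.Star v) with he | hne
  · simp
  obtain ⟨s₀, hs₀⟩ := Finite.exists_min fun s : T.Star v => Metric.diam (s.1 : Set (Pt d))
  set ρ := Metric.diam (s₀.1 : Set (Pt d))
  have hρ : 0 < ρ := diam_pos (by rw [s₀.2.2.1]; omega)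
  choose c hc using fun s : T.Star v =>
    exists_ball_subset hd hκ (hT s.1 s.2.1 s.2.2.1) s.2.2.1 s.2.2.2 hρ (hs₀ s)
  have hdisj : Pairwise fun s t : T.Star v =>
      Disjoint (Metric.ball (c s) (κ * ρ)) (Metric.ball (c t) (κ * ρ)) := fun s t hst =>
    (T.disjoint_interior s.2.1 s.2.2.1 t.2.1 t.2.2.1 fun h => hst (Subtype.ext h)).mono
      ((hc s).trans inter_subset_left) ((hc t).trans inter_subset_left)
  have h1 : ∑ s : T.Star v, MeasureTheory.volume.real (Metric.ball (c s) (κ * ρ)) ≤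
      MeasureTheory.volume.real (Metric.closedBall v ρ) := by
    have h2 : MeasureTheory.volume.real (⋃ s, Metric.ball (c s) (κ * ρ)) =
        ∑ s : T.Star v, MeasureTheory.volume.real (Metric.ball (c s) (κ * ρ)) := by
      have := MeasureTheory.measureReal_biUnion_finset
        (μ := (MeasureTheory.volume : MeasureTheory.Measure (Pt d))) (s := Finset.univ)
        (f := fun s : T.Star v => Metric.ball (c s) (κ * ρ))
        (fun s _ t _ hst => hdisj hst) (fun s _ => measurableSet_ball)
      simpa using this
    rw [← h2]
    exact MeasureTheory.measureReal_mono (iUnion_subset fun s => (hc s).trans inter_subset_right)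
      MeasureTheory.measure_closedBall_lt_top.ne
  have hω := unitBallVolume_pos d
  rw [volume_real_closedBall v hρ.le,
    Finset.sum_congr rfl fun s _ => volume_real_ball (c s) (mul_pos hκ hρ)] at h1
  rw [Finset.sum_const, nsmul_eq_mul, ← mul_assoc] at h1
  have h2 := le_of_mul_le_mul_right h1 hω
  rw [mul_pow, ← mul_assoc] at h2
  rw [Nat.card_eq_fintype_card, ← Finset.card_univ]
  refine le_of_mul_le_mul_right (a := ρ ^ d) ?_ (by positivity)
  rwa [one_mul]

theorem diam_le_of_adj (hd : 2 ≤ d) (hκ : 0 < κ)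
    (hT : ∀ s ∈ T.faces, s.card = d + 1 → IsChunky κ s) {s t : T.Star v}
    (h : (T.starGraph v).Adj s t) :
    Metric.diam (s.1 : Set (Pt d)) ≤ κ⁻¹ * Metric.diam (t.1 : Set (Pt d)) := by
  obtain ⟨-, F, hFs, hFt, hFc⟩ := h
  obtain ⟨u, hu, w, hw, huw⟩ := Finset.one_lt_card.1 (show 1 < F.card by omega)
  have h1 := (T.isFullSimplex s.2.1 s.2.2.1).mul_diam_le_dist hκ.le
    (hT s.1 s.2.1 s.2.2.1) (hFs hu) (hFs hw) huw
  have h2 : dist u w ≤ Metric.diam (t.1 : Set (Pt d)) :=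
    dist_le_diam (subset_convexHull ℝ _ (hFt hu)) (subset_convexHull ℝ _ (hFt hw))
  rw [inv_mul_eq_div, le_div_iff₀ hκ]
  linarith

theorem diam_le_of_walk (hd : 2 ≤ d) (hκ : 0 < κ)
    (hT : ∀ s ∈ T.faces, s.card = d + 1 → IsChunky κ s) {s t : T.Star v}
    (p : (T.starGraph v).Walk s t) :
    Metric.diam (s.1 : Set (Pt d)) ≤ κ⁻¹ ^ p.length * Metric.diam (t.1 : Set (Pt d)) := by
  induction p with
  | nil => simp
  | cons h p ih =>
    calc _ ≤ κ⁻¹ * _ := T.diam_le_of_adj hd hκ hT h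
      _ ≤ κ⁻¹ * (κ⁻¹ ^ p.length * _) := by gcongr
      _ = _ := by rw [SimpleGraph.Walk.length_cons, pow_succ']; ring

/-- Elements of the star of a node that are connected through common facets are of comparable
size. -/
theorem diam_le_of_reachable (hd : 2 ≤ d) (hκ : 0 < κ) (hκ1 : κ ≤ 1)
    (hT : ∀ s ∈ T.faces, s.card = d + 1 → IsChunky κ s) {s t : T.Star v}
    (h : (T.starGraph v).Reachable s t) :
    Metric.diam (s.1 : Set (Pt d)) ≤
      κ⁻¹ ^ ⌈κ⁻¹ ^ d⌉₊ * Metric.diam (t.1 : Set (Pt d)) := by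
  classical
  have := Fintype.ofFinite (T.Star v)
  obtain ⟨p, hp⟩ := h.exists_isPath
  refine (T.diam_le_of_walk hd hκ hT p).trans ?_
  have h1 : p.length ≤ ⌈κ⁻¹ ^ d⌉₊ := by
    have h2 := T.card_star_mul_le (by omega) hκ hT v
    rw [← le_div_iff₀ (by positivity), one_div, ← inv_pow] at h2
    have h3 : Nat.card (T.Star v) ≤ ⌈κ⁻¹ ^ d⌉₊ := by exact_mod_cast h2.trans (Nat.le_ceil _)
    rw [Nat.card_eq_fintype_card] at h3
    exact hp.length_lt.le.trans h3
  have h4 : 1 ≤ κ⁻¹ := (one_le_inv₀ hκ).2 hκ1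
  gcongr

end Triangulation

/-! ### The surface measure of boundary faces -/

/-- The vector span of `d` affinely independent points is isometric to `ℝ^(d - 1)`. -/
theorem exists_linearIsometry {F : Finset (Pt d)}
    (hF : AffineIndependent ℝ ((↑) : F → Pt d)) (hd : 1 ≤ d) (hFc : F.card = d) :
    ∃ L : Pt (d - 1) →ₗᵢ[ℝ] Pt d, range L = (vectorSpan ℝ (F : Set (Pt d)) : Set (Pt d)) := by
  have h1 : Module.finrank ℝ (vectorSpan ℝ (F : Set (Pt d))) = d - 1 := by
    have := hF.finrank_vectorSpan (n := d - 1) (by rw [Fintype.card_coe]; omega)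
    rwa [Subtype.range_coe_subtype, show {x | x ∈ F} = (F : Set (Pt d)) from rfl] at this
  let b := (stdOrthonormalBasis ℝ (vectorSpan ℝ (F : Set (Pt d)))).reindex (finCongr h1)
  refine ⟨(vectorSpan ℝ (F : Set (Pt d))).subtypeₗᵢ.comp b.repr.symm.toLinearIsometry, ?_⟩
  ext x
  constructor
  · rintro ⟨y, rfl⟩
    exact (b.repr.symm y).2
  · intro hx
    exact ⟨b.repr ⟨x, hx⟩, by simp⟩

theorem isometry_add_const (L : Pt (d - 1) →ₗᵢ[ℝ] Pt d) (q : Pt d) :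
    Isometry fun y => L y + q :=
  Isometry.of_dist_eq fun x y => by rw [dist_add_right, L.dist_map]

theorem euclideanHausdorffMeasure_facet_lt_top {F : Finset (Pt d)}
    (hF : AffineIndependent ℝ ((↑) : F → Pt d)) (hd : 1 ≤ d) (hFc : F.card = d) :
    μHE[d - 1] (convexHull ℝ (F : Set (Pt d))) < ⊤ := by
  obtain ⟨L, hL⟩ := exists_linearIsometry hF hd hFc
  obtain ⟨q, hq⟩ : F.Nonempty := by rw [← Finset.card_pos, hFc]; exact hd
  have hsub : convexHull ℝ (F : Set (Pt d)) ⊆ (fun y => L y + q) ''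
      Metric.closedBall 0 (Metric.diam (F : Set (Pt d))) := by
    intro x hx
    have h1 : x - q ∈ (vectorSpan ℝ (F : Set (Pt d)) : Set (Pt d)) := by
      rw [← direction_affineSpan]
      exact AffineSubspace.vsub_mem_direction (convexHull_subset_affineSpan _ hx)
        (subset_affineSpan ℝ _ hq)
    rw [← hL] at h1
    obtain ⟨y, hy⟩ := h1
    refine ⟨y, ?_, by simp [hy]⟩
    rw [mem_closedBall_zero_iff, ← L.norm_map, hy, ← dist_eq_norm]
    exact dist_le_diam hx (subset_convexHull ℝ _ hq)
  refine (MeasureTheory.measure_mono hsub).trans_lt ?_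
  rw [(isometry_add_const L q).euclideanHausdorffMeasure_image,
    EuclideanSpace.euclideanHausdorffMeasure_eq_volume]
  exact MeasureTheory.measure_closedBall_lt_top

/-- The facets of a chunky simplex are not much smaller than the simplex. -/
theorem IsFullSimplex.le_euclideanHausdorffMeasure_facet {s F : Finset (Pt d)} {κ : ℝ}
    (H : IsFullSimplex s) (hd : 1 ≤ d) (hκ : 0 < κ) (h : IsChunky κ s) (hF : F ⊆ s)
    (hFc : F.card = d) :
    (κ * Metric.diam (s : Set (Pt d))) ^ (d - 1) * unitBallVolume (d - 1) ≤
      (μHE[d - 1] : MeasureTheory.Measure (Pt d)).real (convexHull ℝ (F : Set (Pt d))) := by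
  have hFi : AffineIndependent ℝ ((↑) : F → Pt d) := H.indep.mono (by exact_mod_cast hF)
  obtain ⟨L, hL⟩ := exists_linearIsometry hFi hd hFc
  obtain ⟨q, hq⟩ := H.exists_ball_facet hd hκ h hF hFc
  have hsub : (fun y => L y + q) '' Metric.closedBall 0 (κ * Metric.diam (s : Set (Pt d))) ⊆
      convexHull ℝ (F : Set (Pt d)) := by
    rintro _ ⟨y, hy, rfl⟩
    refine hq (L y) ?_ ?_
    · rw [← SetLike.mem_coe, ← hL]; exact mem_range_self y
    · rwa [L.norm_map, ← mem_closedBall_zero_iff]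
  rw [← volume_real_closedBall (0 : Pt (d - 1)) (mul_nonneg hκ.le Metric.diam_nonneg),
    ← EuclideanSpace.euclideanHausdorffMeasure_eq_volume, MeasureTheory.measureReal_def,
    ← (isometry_add_const L q).euclideanHausdorffMeasure_image]
  exact MeasureTheory.measureReal_mono hsub (euclideanHausdorffMeasure_facet_lt_top hFi hd hFc).ne

theorem euclideanHausdorffMeasure_convexHull_eq_zero {A : Finset (Pt d)} {k : ℕ}
    (hA : A.card ≤ k) : μHE[k] (convexHull ℝ (A : Set (Pt d))) = 0 := by
  classical
  rcases A.eq_empty_or_nonempty with rfl | hne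
  · simp
  obtain ⟨n, hn⟩ := Nat.exists_eq_succ_of_ne_zero (Finset.card_ne_zero.2 hne)
  have h1 := finrank_vectorSpan_image_finset_le ℝ id A hn
  rw [Finset.image_id] at h1
  have h2 : dimH (convexHull ℝ (A : Set (Pt d))) < ((k : NNReal) : ENNReal) := by
    rw [Real.Convex.dimH_eq_finrank_vectorSpan (convex_convexHull ℝ _)
      ((Finset.coe_nonempty.2 hne).convexHull), ← direction_affineSpan, affineSpan_convexHull,
      direction_affineSpan, ENNReal.coe_natCast, Nat.cast_lt]
    omega
  have h3 : μH[(k : NNReal)] (convexHull ℝ (A : Set (Pt d))) = 0 := hausdorffMeasure_of_dimH_lt h2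
  rw [NNReal.coe_natCast] at h3
  rw [MeasureTheory.Measure.euclideanHausdorffMeasure_def, MeasureTheory.Measure.smul_apply, h3,
    smul_zero]

theorem integrableOn_of_continuousOn {S : Set (Pt d)} {μ : MeasureTheory.Measure (Pt d)}
    (hS : IsCompact S) (hμ : μ S < ⊤) {f : Pt d → ℝ} (hf : ContinuousOn f S) :
    MeasureTheory.IntegrableOn f S μ := by
  obtain ⟨M, hM⟩ := hS.exists_bound_of_continuousOn hf
  refine MeasureTheory.IntegrableOn.of_bound hμ (hf.aestronglyMeasurable hS.measurableSet) M ?_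
  filter_upwards [MeasureTheory.ae_restrict_mem hS.measurableSet] with x hx using hM x hx

/-- The value of an affine function at a vertex of a face is controlled by its mean square on the
face. At every point `x` of the face, it is controlled by the value at `x` or by the value at the
midpoint of `x` and the vertex, so that the set where the function is not small, together with its
image under the homothety with ratio 2, covers the face. -/
theorem sq_mul_measure_le_setIntegral {F : Finset (Pt d)}
    (hF : AffineIndependent ℝ ((↑) : F → Pt d)) (hd : 1 ≤ d) (hFc : F.card = d)
    {v : Pt d} (hv : v ∈ F) {u : Pt d → ℝ} (hu : ContinuousOn u (convexHull ℝ (F : Set (Pt d))))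
    (hmid : ∀ x ∈ convexHull ℝ (F : Set (Pt d)), u (midpoint ℝ v x) = (u v + u x) / 2) :
    u v ^ 2 * (μHE[d - 1] : MeasureTheory.Measure (Pt d)).real (convexHull ℝ (F : Set (Pt d))) ≤
      9 * (1 + 2 ^ (d - 1)) * ∫ x in convexHull ℝ (F : Set (Pt d)), u x ^ 2 ∂μHE[d - 1] := by
  set C := convexHull ℝ (F : Set (Pt d)) with hC
  set μ : MeasureTheory.Measure (Pt d) := μHE[d - 1] with hμ
  have hCc : IsCompact C := Triangulation.isCompact_convexHull F
  have hCtop : μ C < ⊤ := euclideanHausdorffMeasure_facet_lt_top hF hd hFc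
  set A : Set (Pt d) := C ∩ u ⁻¹' {y | u v ^ 2 ≤ 9 * y ^ 2} with hA
  have hAcl : IsClosed A :=
    hu.preimage_isClosed_of_isClosed hCc.isClosed
      (isClosed_le continuous_const (by fun_prop))
  have hAC : A ⊆ C := inter_subset_left
  have hAtop : μ A < ⊤ := (MeasureTheory.measure_mono hAC).trans_lt hCtop
  have hcover : C ⊆ A ∪ AffineMap.homothety v (2 : ℝ) '' A := by
    intro x hx
    by_cases hxA : x ∈ A
    · exact Or.inl hxA
    right
    have hx9 : 9 * u x ^ 2 < u v ^ 2 := by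
      by_contra! h
      exact hxA ⟨hx, h⟩
    have hmC : midpoint ℝ v x ∈ C :=
      (convex_convexHull ℝ _).midpoint_mem (subset_convexHull ℝ _ hv) hx
    refine ⟨midpoint ℝ v x, ⟨hmC, ?_⟩, ?_⟩
    · rw [mem_preimage, mem_ofPred_eq, hmid x hx]
      have h3 : |3 * u x| ≤ |u v| := sq_le_sq.1 (by nlinarith)
      have h4 : |3 * u x| = 3 * |u x| := by rw [abs_mul, abs_of_pos (by norm_num : (0 : ℝ) < 3)]
      rcases abs_cases (u v) with ⟨h5, h6⟩ | ⟨h5, h6⟩ <;>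
        rcases abs_cases (u x) with ⟨h7, h8⟩ | ⟨h7, h8⟩ <;> nlinarith
    · rw [AffineMap.homothety_apply, midpoint_eq_smul_add, vsub_eq_sub, vadd_eq_add]
      rw [smul_sub, smul_smul]
      norm_num
      module
  have hmeas : μ.real C ≤ (1 + 2 ^ (d - 1)) * μ.real A := by
    have h1 : μ.real (AffineMap.homothety v (2 : ℝ) '' A) = 2 ^ (d - 1) * μ.real A := by
      rw [MeasureTheory.measureReal_def, hμ,
        MeasureTheory.euclideanHausdorffMeasure_homothety_image _ v two_ne_zero]
      simp [MeasureTheory.measureReal_def, ENNReal.smul_def]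
    have h2 : μ (AffineMap.homothety v (2 : ℝ) '' A) ≠ ⊤ := by
      rw [hμ, MeasureTheory.euclideanHausdorffMeasure_homothety_image _ v two_ne_zero,
        ENNReal.smul_def]
      exact ENNReal.mul_ne_top ENNReal.coe_ne_top hAtop.ne
    calc μ.real C ≤ μ.real (A ∪ AffineMap.homothety v (2 : ℝ) '' A) :=
          MeasureTheory.measureReal_mono hcover
            (MeasureTheory.measure_union_ne_top hAtop.ne h2)
      _ ≤ μ.real A + μ.real (AffineMap.homothety v (2 : ℝ) '' A) :=
          MeasureTheory.measureReal_union_le _ _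
      _ = _ := by rw [h1]; ring
  have hint : MeasureTheory.IntegrableOn (fun x => u x ^ 2) C μ :=
    integrableOn_of_continuousOn hCc hCtop (hu.pow 2)
  have hlow : u v ^ 2 / 9 * μ.real A ≤ ∫ x in C, u x ^ 2 ∂μ := by
    calc u v ^ 2 / 9 * μ.real A ≤ ∫ x in A, u x ^ 2 ∂μ := by
          refine MeasureTheory.setIntegral_ge_of_const_le_real hAcl.measurableSet hAtop.ne
            (fun x hx => ?_) (hint.mono_set hAC)
          have : u v ^ 2 ≤ 9 * u x ^ 2 := hx.2
          linarith
      _ ≤ ∫ x in C, u x ^ 2 ∂μ :=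
          MeasureTheory.setIntegral_mono_set hint (.of_forall fun x => sq_nonneg _)
            (LE.le.eventuallyLE hAC)
  calc u v ^ 2 * μ.real C ≤ u v ^ 2 * ((1 + 2 ^ (d - 1)) * μ.real A) := by gcongr
    _ = 9 * (1 + 2 ^ (d - 1)) * (u v ^ 2 / 9 * μ.real A) := by ring
    _ ≤ _ := by gcongr

/-- The integrals of a nonnegative function over almost disjoint parts of a set add up to at most
the integral over this set. -/
theorem sum_setIntegral_le {X ι : Type*} [MeasurableSpace X] {μ : MeasureTheory.Measure X}
    [Fintype ι] {s : ι → Set X} {S : Set X} {f : X → ℝ} (hs : ∀ i, MeasurableSet (s i))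
    (hd : Pairwise fun i j => MeasureTheory.AEDisjoint μ (s i) (s j)) (hsub : ∀ i, s i ⊆ S)
    (hf : MeasureTheory.IntegrableOn f S μ) (h0 : ∀ x, 0 ≤ f x) :
    ∑ i, ∫ x in s i, f x ∂μ ≤ ∫ x in S, f x ∂μ := by
  have h1 : ∑ i, ∫ x in s i, f x ∂μ = ∫ x in ⋃ i, s i, f x ∂μ := by
    rw [MeasureTheory.Measure.restrict_iUnion_ae hd fun i => (hs i).nullMeasurableSet,
      MeasureTheory.Measure.sum_fintype,
      MeasureTheory.integral_finsetSum_measure fun i _ => hf.mono_set (hsub i)]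
  rw [h1]
  exact MeasureTheory.setIntegral_mono_set hf (.of_forall h0)
    (LE.le.eventuallyLE (iUnion_subset hsub))

namespace Triangulation

variable (T : Triangulation d)

instance : Finite T.surfaceFaces := (T.finite_faces.subset fun _ hs => hs.1).to_subtype

theorem aedisjoint_surfaceFaces {F G : Finset (Pt d)} (hF : F ∈ T.surfaceFaces)
    (hG : G ∈ T.surfaceFaces) (hFG : F ≠ G) :
    MeasureTheory.AEDisjoint (μHE[d - 1] : MeasureTheory.Measure (Pt d))
      (convexHull ℝ (F : Set (Pt d))) (convexHull ℝ (G : Set (Pt d))) := by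
  classical
  have h1 := T.inter_subset_convexHull hF.1 hG.1
  rw [← Finset.coe_inter] at h1
  refine MeasureTheory.measure_mono_null h1 (euclideanHausdorffMeasure_convexHull_eq_zero ?_)
  have h2 : F ∩ G ⊂ F := by
    refine lt_of_le_of_ne Finset.inter_subset_left fun h => hFG ?_
    exact Finset.eq_of_subset_of_card_le (Finset.inter_eq_left.1 h) (by rw [hF.2.1, hG.2.1])
  have h3 := Finset.card_lt_card h2
  rw [hF.2.1] at h3
  omega

/-- The boundary has finite surface measure, since it is covered by the facets of the elements. -/
theorem euclideanHausdorffMeasure_surface_lt_top (hd : 1 ≤ d) : μHE[d - 1] T.surface < ⊤ := by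
  classical
  have hsub : T.surface ⊆ ⋃ G ∈ {G | G ∈ T.faces ∧ G.card = d},
      convexHull ℝ (G : Set (Pt d)) := by
    intro x hx
    have hxb := T.surface_subset_bulk hx
    obtain ⟨s, hs, hsc, hxs⟩ := T.exists_element_of_mem_bulk hxb
    have H := T.isFullSimplex hs hsc
    obtain ⟨a, ha, hax⟩ : ∃ a ∈ s, H.bary a x ≤ 0 := by
      by_contra! h
      exact (T.mem_surface_iff hxb).1 hx
        (interior_mono (T.convexHull_subset_bulk hs) (H.mem_interior_iff.2 h))
    have hGc : (s.erase a).card = d := by rw [Finset.card_erase_of_mem ha, hsc]; rfl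
    have hG : s.erase a ∈ T.faces := T.toSimplicialComplex.down_closed hs (s.erase_subset a)
      (by rw [← Finset.card_pos, hGc]; exact hd)
    refine mem_biUnion (x := s.erase a)
      (show s.erase a ∈ {G | G ∈ T.faces ∧ G.card = d} from ⟨hG, hGc⟩) ?_
    refine H.mem_convexHull_of_subset (s.erase_subset a)
      (fun v hv => H.mem_convexHull_iff.1 hxs v (Finset.mem_of_mem_erase hv)) fun v hv hvG => ?_
    obtain rfl : v = a := by
      by_contra h
      exact hvG (Finset.mem_erase.2 ⟨h, hv⟩)
    exact le_antisymm hax (H.mem_convexHull_iff.1 hxs v hv)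
  refine (MeasureTheory.measure_mono hsub).trans_lt (MeasureTheory.measure_biUnion_lt_top
    (T.finite_faces.subset fun G hG => hG.1) fun G hG => ?_)
  exact euclideanHausdorffMeasure_facet_lt_top (T.indep hG.1) hd hG.2

theorem diam_le_surfaceMeshWidth {F : Finset (Pt d)} (hF : F ∈ T.surfaceFaces) :
    Metric.diam (F : Set (Pt d)) ≤ T.surfaceMeshWidth := by
  rw [← convexHull_diam]
  exact le_ciSup (f := fun s : T.surfaceFaces => Metric.diam (convexHull ℝ (s.1 : Set (Pt d))))
    (Set.finite_range _).bddAbove ⟨F, hF⟩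

end Triangulation

/-! ### Comparison of the mass matrices -/

/-- The quadratic form of a mass matrix is the squared `L²` norm of the corresponding function. -/
theorem sqNorm_eq_setIntegral {ι : Type*} [Fintype ι] {S : Set (Pt d)}
    {μ : MeasureTheory.Measure (Pt d)} (φ : ι → Pt d → ℝ)
    (hφ : ∀ i j, MeasureTheory.IntegrableOn (fun x => φ j x * φ i x) S μ) (z : ι → ℝ) :
    sqNorm (fun i j => ∫ x in S, φ j x * φ i x ∂μ) z =
      ∫ x in S, (∑ i, z i * φ i x) ^ 2 ∂μ := by
  have h1 : ∀ x, (∑ i, z i * φ i x) ^ 2 = ∑ i, ∑ j, z i * z j * (φ j x * φ i x) := fun x => by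
    rw [sq, Finset.sum_mul_sum]
    exact Finset.sum_congr rfl fun i _ => Finset.sum_congr rfl fun j _ => by ring
  simp_rw [h1]
  rw [MeasureTheory.integral_finsetSum _ fun i _ =>
    MeasureTheory.integrable_finsetSum _ fun j _ => (hφ i j).const_mul _]
  simp only [sqNorm, dotProduct, Matrix.mulVec]
  refine Finset.sum_congr rfl fun i _ => ?_
  rw [MeasureTheory.integral_finsetSum _ fun j _ => (hφ i j).const_mul _, Finset.mul_sum]
  refine Finset.sum_congr rfl fun j _ => ?_
  rw [MeasureTheory.integral_const_mul]
  ring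

/-- The factor that compares the volume of the star of a boundary node with the mesh width times the
area of a boundary face at this node, for elements with shape regularity `κ`. -/
noncomputable def starConst (d : ℕ) (κ : ℝ) : ℝ :=
  (κ⁻¹ ^ ⌈κ⁻¹ ^ d⌉₊) ^ d * κ⁻¹ ^ d * (unitBallVolume d / unitBallVolume (d - 1))

theorem starConst_pos (d : ℕ) {κ : ℝ} (hκ : 0 < κ) : 0 < starConst d κ :=
  mul_pos (by positivity) (div_pos (unitBallVolume_pos d) (unitBallVolume_pos _))

namespace Triangulation

variable (T : Triangulation d) {κ : ℝ} {v : Pt d}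

/-- Every boundary node has a boundary face that is comparable with the star of the node. -/
theorem exists_surfaceFace_star_le (hd : 2 ≤ d) (hκ : 0 < κ) (hκ1 : κ ≤ 1)
    (hT : ∀ s ∈ T.faces, s.card = d + 1 → IsChunky κ s) (hvT : v ∈ T.vertices)
    (hv : v ∈ T.surface) :
    ∃ F ∈ T.surfaceFaces, v ∈ F ∧ ∫ x in T.bulk, T.nodalBasis v x ≤
      starConst d κ * T.surfaceMeshWidth *
        (μHE[d - 1] : MeasureTheory.Measure (Pt d)).real (convexHull ℝ (F : Set (Pt d))) := by
  classical
  have hne : Nonempty (T.Star v) := by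
    obtain ⟨s, hs, hvs, hsc⟩ := T.exists_element _ hvT
    exact ⟨⟨s, hs, hsc, hvs (Finset.mem_singleton_self v)⟩⟩
  obtain ⟨s, hsmax⟩ := Finite.exists_max fun s : T.Star v => Metric.diam (s.1 : Set (Pt d))
  obtain ⟨t, hst, F, hF, hFt, hvF⟩ := T.exists_reachable_surfaceFaces hv s
  refine ⟨F, hF, hvF, ?_⟩
  set δ := Metric.diam (t.1 : Set (Pt d)) with hδ
  set μF := (μHE[d - 1] : MeasureTheory.Measure (Pt d)).real (convexHull ℝ (F : Set (Pt d)))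
  have hδ0 : 0 ≤ δ := Metric.diam_nonneg
  have hs0 : 0 ≤ Metric.diam (s.1 : Set (Pt d)) := Metric.diam_nonneg
  have hω := unitBallVolume_pos d
  have hω' := unitBallVolume_pos (d - 1)
  have Ht := T.isFullSimplex t.2.1 t.2.2.1
  have hchunky := hT t.1 t.2.1 t.2.2.1
  -- The support of the basis function lies in a ball about the node.
  have hball : ∫ x in T.bulk, T.nodalBasis v x ≤
      Metric.diam (s.1 : Set (Pt d)) ^ d * unitBallVolume d := by
    rw [← volume_real_closedBall v hs0]
    have hfin : MeasureTheory.volume T.bulk < ⊤ := T.isCompact_bulk.measure_lt_top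
    calc ∫ x in T.bulk, T.nodalBasis v x
        ≤ ∫ x in T.bulk, (Metric.closedBall v (Metric.diam (s.1 : Set (Pt d)))).indicator
            (fun _ => (1 : ℝ)) x := by
          refine MeasureTheory.setIntegral_mono_on
            (integrableOn_of_continuousOn T.isCompact_bulk hfin (T.nodalBasis_continuousOn v))
            ((MeasureTheory.integrableOn_const hfin.ne).indicator measurableSet_closedBall)
            T.isCompact_bulk.measurableSet fun x hx => ?_
          by_cases h0 : T.nodalBasis v x = 0
          · rw [h0]
            exact Set.indicator_nonneg (fun _ _ => zero_le_one) x
          · obtain ⟨r, hr, hrc, hxr⟩ := T.exists_element_of_mem_bulk hx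
            have hvr := T.mem_of_nodalBasis_ne_zero hr hxr h0
            rw [Set.indicator_of_mem]
            · exact T.nodalBasis_le_one hx v
            · exact Metric.mem_closedBall.2 ((dist_le_diam hxr (subset_convexHull ℝ _ hvr)).trans
                (hsmax ⟨r, hr, hrc, hvr⟩))
      _ = MeasureTheory.volume.real
            (Metric.closedBall v (Metric.diam (s.1 : Set (Pt d))) ∩ T.bulk) := by
          rw [MeasureTheory.integral_indicator measurableSet_closedBall,
            MeasureTheory.Measure.restrict_restrict measurableSet_closedBall]
          simp
      _ ≤ _ := MeasureTheory.measureReal_mono inter_subset_left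
            MeasureTheory.measure_closedBall_lt_top.ne
  have hsδ := T.diam_le_of_reachable hd hκ hκ1 hT hst
  have hwidth : κ * δ ≤ T.surfaceMeshWidth := by
    obtain ⟨u, hu, w, hw, huw⟩ := Finset.one_lt_card.1 (show 1 < F.card by rw [hF.2.1]; omega)
    calc κ * δ ≤ dist u w := Ht.mul_diam_le_dist hκ.le hchunky (hFt hu) (hFt hw) huw
      _ ≤ Metric.diam (F : Set (Pt d)) :=
          dist_le_diam (subset_convexHull ℝ _ hu) (subset_convexHull ℝ _ hw)
      _ ≤ _ := T.diam_le_surfaceMeshWidth hF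
  have harea := Ht.le_euclideanHausdorffMeasure_facet (by omega) hκ hchunky hFt hF.2.1
  have hw0 : 0 ≤ T.surfaceMeshWidth := (mul_nonneg hκ.le hδ0).trans hwidth
  have hpow : (κ * δ) ^ d * unitBallVolume (d - 1) ≤ T.surfaceMeshWidth * μF := by
    calc (κ * δ) ^ d * unitBallVolume (d - 1)
        = (κ * δ) * ((κ * δ) ^ (d - 1) * unitBallVolume (d - 1)) := by
          rw [← mul_assoc, ← pow_succ', Nat.sub_add_cancel (by omega)]
      _ ≤ T.surfaceMeshWidth * μF := by gcongr
  set N := ⌈κ⁻¹ ^ d⌉₊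
  calc ∫ x in T.bulk, T.nodalBasis v x
      ≤ Metric.diam (s.1 : Set (Pt d)) ^ d * unitBallVolume d := hball
    _ ≤ (κ⁻¹ ^ N * δ) ^ d * unitBallVolume d := by gcongr
    _ = starConst d κ * ((κ * δ) ^ d * unitBallVolume (d - 1)) := by
        have hC : starConst d κ = (κ⁻¹ ^ N) ^ d * κ⁻¹ ^ d *
          (unitBallVolume d / unitBallVolume (d - 1)) := rfl
        rw [hC, mul_pow, mul_pow κ δ d]
        generalize κ⁻¹ ^ N = X
        rw [inv_pow κ d]
        field_simp
    _ ≤ starConst d κ * (T.surfaceMeshWidth * μF) := by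
        have := starConst_pos d hκ
        gcongr
    _ = _ := by ring

/-- The finite element function with given values at the boundary nodes and the value zero at the
interior nodes. -/
noncomputable def boundaryFunction (z : T.SurfaceNode → ℝ) (x : Pt d) : ℝ :=
  ∑ i, z i * T.nodalBasis i.1.1 x

theorem boundaryFunction_continuousOn (z : T.SurfaceNode → ℝ) :
    ContinuousOn (T.boundaryFunction z) T.bulk :=
  continuousOn_finsetSum _ fun i _ => (T.nodalBasis_continuousOn i.1.1).const_smul (z i)

theorem boundaryFunction_node (z : T.SurfaceNode → ℝ) (i : T.SurfaceNode) :
    T.boundaryFunction z i.1.1 = z i := by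
  classical
  rw [boundaryFunction, Finset.sum_eq_single i]
  · rw [T.nodalBasis_node, if_pos rfl, mul_one]
  · intro j _ hj
    rw [T.nodalBasis_node, if_neg fun h => hj (Subtype.ext h), mul_zero]
  · exact fun h => absurd (Finset.mem_univ i) h

theorem boundaryFunction_midpoint (z : T.SurfaceNode → ℝ) {F : Finset (Pt d)} (hF : F ∈ T.faces)
    {x y : Pt d} (hx : x ∈ convexHull ℝ (F : Set (Pt d)))
    (hy : y ∈ convexHull ℝ (F : Set (Pt d))) :
    T.boundaryFunction z (midpoint ℝ x y) =
      (T.boundaryFunction z x + T.boundaryFunction z y) / 2 := by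
  rw [boundaryFunction, boundaryFunction, boundaryFunction, ← Finset.sum_add_distrib,
    Finset.sum_div]
  refine Finset.sum_congr rfl fun i _ => ?_
  obtain ⟨f, hf⟩ := T.nodalBasis_affine hF i.1.1
  rw [hf hx, hf hy, hf ((convex_convexHull ℝ _).midpoint_mem hx hy), AffineMap.map_midpoint,
    midpoint_eq_smul_add, smul_eq_mul, invOf_eq_inv]
  ring

theorem boundaryFunction_sq_le (z : T.SurfaceNode → ℝ) {x : Pt d} (hx : x ∈ T.bulk) :
    T.boundaryFunction z x ^ 2 ≤ ∑ i, z i ^ 2 * T.nodalBasis i.1.1 x := by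
  classical
  have h0 : ∀ i : T.SurfaceNode, 0 ≤ T.nodalBasis i.1.1 x := fun i => T.nodalBasis_nonneg hx _
  have h1 : ∑ i : T.SurfaceNode, T.nodalBasis i.1.1 x ≤ 1 := by
    let e : T.SurfaceNode ↪ Pt d :=
      ⟨fun i => i.1.1, fun i j h => Subtype.ext (Subtype.ext h)⟩
    have := T.sum_nodalBasis_le_one hx (Finset.univ.map e)
    rwa [Finset.sum_map] at this
  have h2 : T.boundaryFunction z x ^ 2 ≤ (∑ i : T.SurfaceNode, T.nodalBasis i.1.1 x) *
      ∑ i, z i ^ 2 * T.nodalBasis i.1.1 x :=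
    Finset.sum_sq_le_sum_mul_sum_of_sq_le_mul _ (fun i _ => h0 i)
      (fun i _ => mul_nonneg (sq_nonneg _) (h0 i)) fun i _ => le_of_eq (by ring)
  exact h2.trans (mul_le_of_le_one_left
    (Finset.sum_nonneg fun i _ => mul_nonneg (sq_nonneg _) (h0 i)) h1)

theorem sqNorm_bulkMass22_le (z : T.SurfaceNode → ℝ) :
    sqNorm T.bulkMass22 z ≤ ∑ i, z i ^ 2 * ∫ x in T.bulk, T.nodalBasis i.1.1 x := by
  have hfin : MeasureTheory.volume T.bulk < ⊤ := T.isCompact_bulk.measure_lt_top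
  have hint := fun i : T.SurfaceNode =>
    integrableOn_of_continuousOn T.isCompact_bulk hfin (T.nodalBasis_continuousOn i.1.1)
  have h1 : sqNorm T.bulkMass22 z = ∫ x in T.bulk, T.boundaryFunction z x ^ 2 :=
    sqNorm_eq_setIntegral (fun i : T.SurfaceNode => T.nodalBasis i.1.1)
      (fun i j => integrableOn_of_continuousOn T.isCompact_bulk hfin
        ((T.nodalBasis_continuousOn j.1.1).mul (T.nodalBasis_continuousOn i.1.1))) z
  rw [h1]
  calc ∫ x in T.bulk, T.boundaryFunction z x ^ 2
      ≤ ∫ x in T.bulk, ∑ i, z i ^ 2 * T.nodalBasis i.1.1 x :=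
        MeasureTheory.setIntegral_mono_on
          (integrableOn_of_continuousOn T.isCompact_bulk hfin
            ((T.boundaryFunction_continuousOn z).pow 2))
          (MeasureTheory.integrable_finsetSum _ fun i _ => (hint i).const_mul _)
          T.isCompact_bulk.measurableSet fun x hx => T.boundaryFunction_sq_le z hx
    _ = _ := by
        rw [MeasureTheory.integral_finsetSum _ fun i _ => (hint i).const_mul _]
        exact Finset.sum_congr rfl fun i _ => MeasureTheory.integral_const_mul _ _

theorem sqNorm_surfaceMass_eq (hd : 1 ≤ d) (z : T.SurfaceNode → ℝ) :
    sqNorm T.surfaceMass z = ∫ x in T.surface, T.boundaryFunction z x ^ 2 ∂μHE[d - 1] :=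
  sqNorm_eq_setIntegral (fun i : T.SurfaceNode => T.nodalBasis i.1.1)
    (fun i j => integrableOn_of_continuousOn T.isCompact_surface
      (T.euclideanHausdorffMeasure_surface_lt_top hd)
      (((T.nodalBasis_continuousOn j.1.1).mul (T.nodalBasis_continuousOn i.1.1)).mono
        T.surface_subset_bulk)) z

/-- If a boundary face is chosen at every boundary node, the squares of the nodal values, weighted
with the areas of these faces, are controlled by the `L²` norm on the boundary. -/
theorem sum_sq_mul_measure_le (hd : 1 ≤ d) (z : T.SurfaceNode → ℝ)
    (F : T.SurfaceNode → T.surfaceFaces) (hF : ∀ i, i.1.1 ∈ (F i).1) :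
    ∑ i, z i ^ 2 * (μHE[d - 1] : MeasureTheory.Measure (Pt d)).real
        (convexHull ℝ ((F i).1 : Set (Pt d))) ≤
      9 * (1 + 2 ^ (d - 1)) * d * sqNorm T.surfaceMass z := by
  classical
  have := Fintype.ofFinite T.surfaceFaces
  set g : T.surfaceFaces → ℝ := fun G =>
    ∫ x in convexHull ℝ (G.1 : Set (Pt d)), T.boundaryFunction z x ^ 2 ∂μHE[d - 1] with hg
  have hg0 : ∀ G, 0 ≤ g G := fun G => MeasureTheory.integral_nonneg fun x => sq_nonneg _
  have hnode : ∀ i, z i ^ 2 * (μHE[d - 1] : MeasureTheory.Measure (Pt d)).real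
      (convexHull ℝ ((F i).1 : Set (Pt d))) ≤ 9 * (1 + 2 ^ (d - 1)) * g (F i) := fun i => by
    have hFi := (F i).2
    have := sq_mul_measure_le_setIntegral (T.indep hFi.1) hd hFi.2.1 (hF i)
      ((T.boundaryFunction_continuousOn z).mono (T.convexHull_subset_bulk hFi.1))
      fun x hx => T.boundaryFunction_midpoint z hFi.1 (subset_convexHull ℝ _ (hF i)) hx
    rwa [T.boundaryFunction_node] at this
  -- A face is chosen by at most `d` nodes.
  have hcount : ∑ i, g (F i) ≤ d * ∑ G, g G := by
    rw [← Finset.sum_fiberwise Finset.univ F fun i => g (F i), Finset.mul_sum]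
    refine Finset.sum_le_sum fun G _ => ?_
    rw [Finset.sum_congr rfl fun i hi => by rw [(Finset.mem_filter.1 hi).2], Finset.sum_const,
      nsmul_eq_mul]
    refine mul_le_mul_of_nonneg_right ?_ (hg0 G)
    have h1 : (Finset.univ.filter fun i => F i = G).card ≤ G.1.card := by
      refine Finset.card_le_card_of_injOn (fun i => i.1.1) (fun i hi => ?_)
        fun i _ j _ h => Subtype.ext (Subtype.ext h)
      have h2 := hF i
      rw [(Finset.mem_filter.1 hi).2] at h2
      exact h2
    rw [G.2.2.1] at h1
    exact_mod_cast h1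
  have hsum : ∑ G, g G ≤ sqNorm T.surfaceMass z := by
    rw [T.sqNorm_surfaceMass_eq hd]
    refine sum_setIntegral_le (fun G => (isCompact_convexHull G.1).measurableSet)
      (fun G G' h => T.aedisjoint_surfaceFaces G.2 G'.2 fun h' => h (Subtype.ext h'))
      (fun G => G.2.2.2) ?_ fun x => sq_nonneg _
    exact integrableOn_of_continuousOn T.isCompact_surface
      (T.euclideanHausdorffMeasure_surface_lt_top hd)
      (((T.boundaryFunction_continuousOn z).pow 2).mono T.surface_subset_bulk)
  calc _ ≤ ∑ i, 9 * (1 + 2 ^ (d - 1)) * g (F i) := Finset.sum_le_sum fun i _ => hnode i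
    _ = 9 * (1 + 2 ^ (d - 1)) * ∑ i, g (F i) := by rw [Finset.mul_sum]
    _ ≤ 9 * (1 + 2 ^ (d - 1)) * (d * sqNorm T.surfaceMass z) := by
        gcongr
        exact hcount.trans (by gcongr)
    _ = _ := by ring

theorem surfaceMeshWidth_nonneg : 0 ≤ T.surfaceMeshWidth :=
  Real.iSup_nonneg fun _ => Metric.diam_nonneg

theorem sqNorm_surfaceMass_nonneg (hd : 1 ≤ d) (z : T.SurfaceNode → ℝ) :
    0 ≤ sqNorm T.surfaceMass z := by
  rw [T.sqNorm_surfaceMass_eq hd]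
  exact MeasureTheory.integral_nonneg fun x => sq_nonneg _

/-- The comparison of the two mass matrices in any dimension `d ≥ 2`, with an explicit constant. -/
theorem sqNorm_bulkMass22_le_sqNorm_surfaceMass (hd : 2 ≤ d) (hκ : 0 < κ) (hκ1 : κ ≤ 1)
    (hT : ∀ s ∈ T.faces, s.card = d + 1 → IsChunky κ s) (z : T.SurfaceNode → ℝ) :
    sqNorm T.bulkMass22 z ≤ starConst d κ * (9 * (1 + 2 ^ (d - 1)) * d) *
      T.surfaceMeshWidth * sqNorm T.surfaceMass z := by
  choose F hF hvF hle using fun i : T.SurfaceNode =>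
    T.exists_surfaceFace_star_le hd hκ hκ1 hT i.1.2 i.2
  have h1 := T.sum_sq_mul_measure_le (by omega) z (fun i => ⟨F i, hF i⟩) hvF
  have hC := starConst_pos d hκ
  have hw := T.surfaceMeshWidth_nonneg
  calc sqNorm T.bulkMass22 z ≤ ∑ i, z i ^ 2 * ∫ x in T.bulk, T.nodalBasis i.1.1 x :=
        T.sqNorm_bulkMass22_le z
    _ ≤ ∑ i, z i ^ 2 * (starConst d κ * T.surfaceMeshWidth *
          (μHE[d - 1] : MeasureTheory.Measure (Pt d)).real
            (convexHull ℝ ((F i : Finset (Pt d)) : Set (Pt d)))) :=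
        Finset.sum_le_sum fun i _ => mul_le_mul_of_nonneg_left (hle i) (sq_nonneg _)
    _ = starConst d κ * T.surfaceMeshWidth * ∑ i, z i ^ 2 *
          (μHE[d - 1] : MeasureTheory.Measure (Pt d)).real
            (convexHull ℝ ((F i : Finset (Pt d)) : Set (Pt d))) := by
        rw [Finset.mul_sum]
        exact Finset.sum_congr rfl fun i _ => by ring
    _ ≤ starConst d κ * T.surfaceMeshWidth *
          (9 * (1 + 2 ^ (d - 1)) * d * sqNorm T.surfaceMass z) :=
        mul_le_mul_of_nonneg_left h1 (mul_nonneg hC.le hw)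
    _ = _ := by ring

end Triangulation

end BulkSurface

theorem mainTheorem3 (ϑ : ℝ) (hϑ : 2 ≤ ϑ) :
    ∃ c : ℝ, 0 < c ∧
      ∀ (d : ℕ) [NeZero d], d = 2 ∨ d = 3 →
        ∀ T : BulkSurface.Triangulation d, T.IsQuasiUniform ϑ →
          ∀ z : T.SurfaceNode → ℝ,
            BulkSurface.sqNorm T.bulkMass22 z ≤
              c * T.surfaceMeshWidth * BulkSurface.sqNorm T.surfaceMass z := by
  have hκ : 0 < (2 * ϑ)⁻¹ := by positivity
  have hκ1 : (2 * ϑ)⁻¹ ≤ 1 := inv_le_one_of_one_le₀ (by linarith)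
  set C : ℕ → ℝ := fun d =>
    BulkSurface.starConst d (2 * ϑ)⁻¹ * (9 * (1 + 2 ^ (d - 1)) * d)
  have hpos : ∀ d, 0 < d → 0 < C d := fun d hd =>
    mul_pos (BulkSurface.starConst_pos d hκ) (by positivity)
  refine ⟨max (C 2) (C 3), lt_max_of_lt_left (hpos 2 two_pos), fun d _ hd T hT z => ?_⟩
  have hd2 : 2 ≤ d := by omega
  have hCd : C d ≤ max (C 2) (C 3) := by
    rcases hd with rfl | rfl
    · exact le_max_left _ _
    · exact le_max_right _ _
  have hw := T.surfaceMeshWidth_nonneg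
  have hn := T.sqNorm_surfaceMass_nonneg (by omega) z
  refine (T.sqNorm_bulkMass22_le_sqNorm_surfaceMass hd2 hκ hκ1
    (fun s hs hsc => hT.isChunky (by linarith) hs hsc) z).trans ?_
  gcongr
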